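/- **Setting.** Let $k\ge 1$ be odd, $k=2m+1$, let $M$ be a smooth manifold of dimension $k+1=2m+2$, and let $TM\simeq S^k(E)$ be a $GL(2)$-structure on $M$: an isomorphism of smooth vector bundles, where $E\to M$ is a smooth real vector bundle of rank $2$. Let $B(E)\to M$ be the principal $GL(2)$-bundle of frames $(x^k,x^{k-1}y,\dots,y^k)$ of $TM$ given by bases $(x,y)$ of the fibres of $E$, with the right action $(x,y)\mapsto(x,y)g$, and let $CO(2)=\left\{\begin{pmatrix}u&-v\\ v&u\end{pmatrix}: u^2+v^2\neq0\right\}$. Let $\omega$ be the soldering form of $B(E)$, with values in the space $\mathbb V_k$ of homogeneous polynomials of degree $k$ in $x,y$. For $0\le j\le m$ write $(x^2+y^2)^j(x+iy)^{k-2j}=V_j^{even}+iV_j^{odd}$ with real $V_j^{even},V_j^{odd}\in\mathbb V_k$, let $(\xi_j^{even},\xi_j^{odd})_{j}$ be the basis of $\mathbb V_k^*$ dual to $(V_j^{even},V_j^{odd})_j$, and put $\xi_j=(\xi_j^{even}+i\,\xi_j^{odd})\circ\omega$. Let $\phi=\begin{pmatrix}\phi^1_1&\phi^2_1\\ \phi^1_2&\phi^2_2\end{pmatrix}$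 be the $\mathfrak{gl}(2)$-valued $1$-form on $B(E)$ of a $GL(2)$-connection, and put $\zeta=(\phi^1_2+\phi^2_1)+i(\phi^2_2-\phi^1_1)$. Let $J_\phi$ be the almost-complex structure on the quotient $B(E)/CO(2)$ whose $(1,0)$-forms pull back to $B(E)$ to the linear combinations of $\xi_0,\dots,\xi_m,\zeta$. A *holomorphic section* of $B(E)/CO(2)\to M$ is a smooth section $\sigma$ whose image is a complex submanifold, i.e. such that every $d\sigma(T_pM)$ is $J_\phi$-invariant. Identify the class of $(x,y)$ in $B(E)/CO(2)$ with the complex line $[x+iy]\in P(E^{\mathbb C})\setminus P(E)$. For $z=x+iy$ with $(x,y)$ a basis of $E_p$ and $\bar z=x-iy$, let $J_z$ be the complex structure on $T_pM$ whose space of $(0,1)$-vectors in $T_p^{\mathbb C}M\simeq S^k(E_p^{\mathbb C})$ (the $(-i)$-eigenspace) is spanned by $z^k,z^{k-1}\bar z,\dots,z^{m+1}\bar z^{m}$; it depends only on $[z]$. **Theorem.** Suppose that $J_\phi$ is integrable. Then every holomorphic section $\sigma$ of $B(E)/CO(2)\to M$ gives a complex structure on $M$: the field $p\mapsto J_{z_p}$,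 where $[z_p]\in P(E^{\mathbb C}_p)\setminus P(E_p)$ is the image of $\sigma(p)$, is an integrable almost-complex structure on $M$. (Integrable means that around each point there are smooth complex coordinates whose differential carries the almost-complex structure to multiplication by $i$.) -/

import Mathlib

open scoped Manifold ContDiff TensorProduct
open Bundle

namespace GL2

section Polynomials
open Polynomial

/-- `W_i^{even}(x, y) = Re (x + i y)^i = ∑ₛ (-1)^s (i choose 2s) x^(i-2s) y^(2s)`, written in the
affine coordinate `x = 1`, `y = X`. -/
noncomputable def evenW (i : ℕ) : ℝ[X] :=
  ∑ s ∈ Finset.range (i / 2 + 1), C ((-1) ^ s * (i.choose (2 * s) : ℝ)) * X ^ (2 * s)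

/-- `W_i^{odd}(x, y) = Im (x + i y)^i`, at `x = 1`, `y = X`. -/
noncomputable def oddW (i : ℕ) : ℝ[X] :=
  ∑ s ∈ Finset.range ((i - 1) / 2 + 1),
    C ((-1) ^ s * (i.choose (2 * s + 1) : ℝ)) * X ^ (2 * s + 1)

/-- `V_{k,j}^{even} = (x² + y²)^j W_{k-2j}^{even}`, at `x = 1`, `y = X`. -/
noncomputable def evenV (k j : ℕ) : ℝ[X] := (1 + X ^ 2) ^ j * evenW (k - 2 * j)

/-- `V_{k,j}^{odd} = (x² + y²)^j W_{k-2j}^{odd}`, at `x = 1`, `y = X`. -/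
noncomputable def oddV (k j : ℕ) : ℝ[X] := (1 + X ^ 2) ^ j * oddW (k - 2 * j)

theorem coeff_evenW (i n : ℕ) :
    (evenW i).coeff n = if n % 2 = 0 then (-1) ^ (n / 2) * (i.choose n : ℝ) else 0 := by
  simp only [evenW, finsetSum_coeff, coeff_C_mul, coeff_X_pow]
  split_ifs with h
  · obtain ⟨s, rfl⟩ : ∃ s, n = 2 * s := ⟨n / 2, by omega⟩
    have : 2 * s / 2 = s := by omega
    rw [this]
    by_cases hs : s ∈ Finset.range (i / 2 + 1)
    · rw [Finset.sum_eq_single_of_mem s hs]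
      · simp
      · intro b _ hb
        rw [if_neg (by omega), mul_zero]
    · rw [Finset.sum_eq_zero, Nat.choose_eq_zero_of_lt]
      · simp
      · simp at hs; omega
      · intro b hb
        rw [if_neg (by rintro h; apply hs; have : b = s := by omega
                       rwa [← this]), mul_zero]
  · apply Finset.sum_eq_zero
    intro b _
    rw [if_neg (by omega), mul_zero]

theorem coeff_oddW (i n : ℕ) :
    (oddW i).coeff n = if n % 2 = 0 then 0 else (-1) ^ (n / 2) * (i.choose n : ℝ) := by
  simp only [oddW, finsetSum_coeff, coeff_C_mul, coeff_X_pow]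
  split_ifs with h
  · apply Finset.sum_eq_zero
    intro b _
    rw [if_neg (by omega), mul_zero]
  · obtain ⟨s, rfl⟩ : ∃ s, n = 2 * s + 1 := ⟨n / 2, by omega⟩
    have : (2 * s + 1) / 2 = s := by omega
    rw [this]
    by_cases hs : s ∈ Finset.range ((i - 1) / 2 + 1)
    · rw [Finset.sum_eq_single_of_mem s hs]
      · simp
      · intro b _ hb
        rw [if_neg (by omega), mul_zero]
    · rw [Finset.sum_eq_zero, Nat.choose_eq_zero_of_lt]
      · simp
      · simp at hs; omega
      · intro b hb
        rw [if_neg (by rintro h; apply hs; have : b = s := by omega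
                       rwa [← this]), mul_zero]

/-- The linear form `z = x + i y`, at `x = 1`, `y = X`. -/
noncomputable def zP : ℂ[X] := 1 + C Complex.I * X

/-- The linear form `z̄ = x - i y`, at `x = 1`, `y = X`. -/
noncomputable def zbarP : ℂ[X] := 1 - C Complex.I * X

theorem zP_pow (i : ℕ) :
    zP ^ i = (evenW i).map Complex.ofRealHom + C Complex.I * (oddW i).map Complex.ofRealHom := by
  ext n
  have h : zP ^ i = ((1 + X) ^ i : ℂ[X]).comp (C Complex.I * X) := by simp [zP]
  rw [h, comp_C_mul_X_coeff, coeff_one_add_X_pow]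
  simp only [coeff_add, coeff_C_mul, coeff_map, coeff_evenW, coeff_oddW]
  split_ifs with h
  · obtain ⟨s, rfl⟩ : ∃ s, n = 2 * s := ⟨n / 2, by omega⟩
    have : 2 * s / 2 = s := by omega
    simp only [this, pow_mul, neg_sq, Complex.I_sq]
    simp [mul_comm]
  · obtain ⟨s, rfl⟩ : ∃ s, n = 2 * s + 1 := ⟨n / 2, by omega⟩
    have : (2 * s + 1) / 2 = s := by omega
    simp [this, pow_mul, pow_succ]; ring

theorem zbarP_pow (i : ℕ) :
    zbarP ^ i = (evenW i).map Complex.ofRealHom - C Complex.I * (oddW i).map Complex.ofRealHom := by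
  ext n
  have h : zbarP ^ i = ((1 + X) ^ i : ℂ[X]).comp (C (-Complex.I) * X) := by
    simp [zbarP, sub_eq_add_neg]
  rw [h, comp_C_mul_X_coeff, coeff_one_add_X_pow]
  simp only [coeff_sub, coeff_C_mul, coeff_map, coeff_evenW, coeff_oddW]
  split_ifs with h
  · obtain ⟨s, rfl⟩ : ∃ s, n = 2 * s := ⟨n / 2, by omega⟩
    have : 2 * s / 2 = s := by omega
    simp only [this, pow_mul, neg_sq, Complex.I_sq]
    simp [mul_comm]
  · obtain ⟨s, rfl⟩ : ∃ s, n = 2 * s + 1 := ⟨n / 2, by omega⟩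
    have : (2 * s + 1) / 2 = s := by omega
    simp [this, pow_mul, pow_succ]; ring

theorem zP_mul_zbarP : zP * zbarP = 1 + X ^ 2 := by
  have : (C Complex.I : ℂ[X]) ^ 2 = -1 := by rw [← C_pow]; simp
  calc zP * zbarP = 1 - (C Complex.I) ^ 2 * X ^ 2 := by simp only [zP, zbarP]; ring
    _ = _ := by rw [this]; ring

theorem evenV_add (k j : ℕ) (h : 2 * j ≤ k) :
    (evenV k j).map Complex.ofRealHom + C Complex.I * (oddV k j).map Complex.ofRealHom
      = zP ^ (k - j) * zbarP ^ j := by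
  have e : k - j = j + (k - 2 * j) := by omega
  rw [e, pow_add, mul_right_comm, ← mul_pow, zP_mul_zbarP, zP_pow]
  simp [evenV, oddV]; ring

theorem evenV_sub (k j : ℕ) (h : 2 * j ≤ k) :
    (evenV k j).map Complex.ofRealHom - C Complex.I * (oddV k j).map Complex.ofRealHom
      = zP ^ j * zbarP ^ (k - j) := by
  have e : k - j = j + (k - 2 * j) := by omega
  rw [e, pow_add, ← mul_assoc, ← mul_pow, zP_mul_zbarP, zbarP_pow]
  simp [evenV, oddV]; ring

theorem natDegree_evenW_le (i : ℕ) : (evenW i).natDegree ≤ i := by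
  rw [natDegree_le_iff_coeff_eq_zero]
  intro n hn
  rw [coeff_evenW, Nat.choose_eq_zero_of_lt hn]; simp

theorem natDegree_oddW_le (i : ℕ) : (oddW i).natDegree ≤ i := by
  rw [natDegree_le_iff_coeff_eq_zero]
  intro n hn
  rw [coeff_oddW, Nat.choose_eq_zero_of_lt hn]; simp

theorem natDegree_mul_le_of (k j : ℕ) (h : 2 * j ≤ k) (P : ℝ[X]) (hP : P.natDegree ≤ k - 2 * j) :
    ((1 + X ^ 2) ^ j * P).natDegree ≤ k := by
  have h1 : ((1 + X ^ 2 : ℝ[X])).natDegree ≤ 2 := by compute_degree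
  calc _ ≤ ((1 + X ^ 2 : ℝ[X]) ^ j).natDegree + P.natDegree := natDegree_mul_le
    _ ≤ j * 2 + (k - 2 * j) := add_le_add (natDegree_pow_le_of_le j h1) hP
    _ = k := by omega

theorem zP_zbarP_independent (k : ℕ) (c : ℕ → ℂ)
    (h : ∑ j ∈ Finset.range (k + 1), C (c j) * (zP ^ (k - j) * zbarP ^ j) = 0) :
    ∀ j ≤ k, c j = 0 := by
  induction k generalizing c with
  | zero =>
    intro j hj
    obtain rfl : j = 0 := by omega
    simpa using h
  | succ k ih =>
    have hz : zP.eval (-Complex.I) = 2 := by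
      simp [zP]; norm_num
    have hzb : zbarP.eval (-Complex.I) = 0 := by simp [zbarP]
    have hne : zbarP ≠ 0 := by
      intro h0
      have : zbarP.eval 0 = 0 := by rw [h0]; simp
      simp [zbarP] at this
    rw [Finset.sum_range_succ'] at h
    have h0 : c 0 = 0 := by
      have := congrArg (Polynomial.eval (-Complex.I)) h
      simpa [eval_finsetSum, hz, hzb] using this
    have hs : zbarP * ∑ j ∈ Finset.range (k + 1), C (c (j + 1)) * (zP ^ (k - j) * zbarP ^ j) = 0 := by
      rw [h0] at h
      simp only [C_0, zero_mul, add_zero] at h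
      rw [← h, Finset.mul_sum]
      apply Finset.sum_congr rfl
      intro j _
      rw [Nat.add_sub_add_right, pow_succ]; ring
    have := ih (fun j => c (j + 1)) ((mul_eq_zero.1 hs).resolve_left hne)
    intro j hj
    rcases j with _ | j
    · exact h0
    · exact this j (by omega)

/-- The space `𝕍_k` of homogeneous polynomials of degree `k` in `x, y` is identified with
`Fin (k + 1) → ℝ` through the basis `x^k, x^(k-1) y, …, y^k`; this is the coefficient vector of the
homogeneous polynomial whose value at `x = 1`, `y = X` is `P`. -/
def coeffVec (k : ℕ) (P : ℝ[X]) : Fin (k + 1) → ℝ := fun i => P.coeff i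

/-- The vectors `V_{k,j}^{even}`, `V_{k,j}^{odd}`, `0 ≤ j ≤ m`, of `𝕍_k`, `k = 2m + 1`. -/
noncomputable def evenOddVec (m : ℕ) : Fin (m + 1) ⊕ Fin (m + 1) → (Fin (2 * m + 1 + 1) → ℝ) :=
  Sum.elim (fun j => coeffVec (2 * m + 1) (evenV (2 * m + 1) j))
    (fun j => coeffVec (2 * m + 1) (oddV (2 * m + 1) j))

theorem linearIndependent_evenOddVec (m : ℕ) : LinearIndependent ℝ (evenOddVec m) := by
  rw [Fintype.linearIndependent_iff]
  intro g hg
  set a : ℕ → ℝ := fun j => if h : j < m + 1 then g (Sum.inl ⟨j, h⟩) else 0 with ha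
  set b : ℕ → ℝ := fun j => if h : j < m + 1 then g (Sum.inr ⟨j, h⟩) else 0 with hb
  have ha' : ∀ j : Fin (m + 1), a j = g (Sum.inl j) := fun j => by simp only [ha, dif_pos j.2]
  have hb' : ∀ j : Fin (m + 1), b j = g (Sum.inr j) := fun j => by simp only [hb, dif_pos j.2]
  have hpoly : ∑ j ∈ Finset.range (m + 1),
      (C (a j) * evenV (2 * m + 1) j + C (b j) * oddV (2 * m + 1) j) = 0 := by
    ext n
    rw [coeff_zero, finsetSum_coeff]
    by_cases hn : n < 2 * m + 1 + 1
    · have := congrFun hg ⟨n, hn⟩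
      rw [Finset.sum_range]
      simp only [coeff_add, coeff_C_mul, ha', hb', Finset.sum_add_distrib]
      simpa [Fintype.sum_sum_type, evenOddVec, coeffVec] using this
    · apply Finset.sum_eq_zero
      intro j hj
      have hj' : 2 * j ≤ 2 * m + 1 := by simp at hj; omega
      have h1 := natDegree_mul_le_of _ j hj' _ (natDegree_evenW_le _)
      have h2 := natDegree_mul_le_of _ j hj' _ (natDegree_oddW_le _)
      rw [coeff_add, coeff_C_mul, coeff_C_mul, evenV, oddV,
        coeff_eq_zero_of_natDegree_lt (by omega), coeff_eq_zero_of_natDegree_lt (by omega)]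
      simp
  set c : ℕ → ℂ := fun j => if j < m + 1 then (a j - Complex.I * b j) / 2
    else (a (2 * m + 1 - j) + Complex.I * b (2 * m + 1 - j)) / 2 with hc
  have key : ∑ j ∈ Finset.range (2 * m + 1 + 1),
      C (c j) * (zP ^ (2 * m + 1 - j) * zbarP ^ j) = 0 := by
    have hr : 2 * m + 1 + 1 = (m + 1) + (m + 1) := by omega
    have e1 : ∑ j ∈ Finset.range (m + 1), C (c (m + 1 + j)) *
        (zP ^ (2 * m + 1 - (m + 1 + j)) * zbarP ^ (m + 1 + j)) =
        ∑ j ∈ Finset.range (m + 1), C ((a j + Complex.I * b j) / 2) *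
        (zP ^ j * zbarP ^ (2 * m + 1 - j)) := by
      rw [← Finset.sum_range_reflect]
      apply Finset.sum_congr rfl
      intro j hj
      simp only [Finset.mem_range] at hj
      have t1 : m + 1 + (m + 1 - 1 - j) = 2 * m + 1 - j := by omega
      have t2 : 2 * m + 1 - (2 * m + 1 - j) = j := by omega
      have t3 : ¬ (2 * m + 1 - j < m + 1) := by omega
      rw [t1, t2]
      simp only [hc, if_neg t3, t2]
    rw [hr, Finset.sum_range_add, e1, ← Finset.sum_add_distrib]
    have := congrArg (Polynomial.map Complex.ofRealHom) hpoly
    rw [Polynomial.map_sum, Polynomial.map_zero] at this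
    rw [← this]
    apply Finset.sum_congr rfl
    intro j hj
    have hj' : 2 * j ≤ 2 * m + 1 := by simp at hj; omega
    simp only [Finset.mem_range] at hj
    simp only [hc, if_pos hj]
    rw [← evenV_add _ _ hj', ← evenV_sub _ _ hj']
    simp only [Polynomial.map_add, Polynomial.map_mul, map_C, Complex.ofRealHom_eq_coe]
    have h2 : ∀ w : ℂ, C (w / 2) = C (1 / 2) * C w := fun w => by rw [← C_mul]; congr 1; ring
    rw [h2, h2 (_ + _), C_sub, C_add, C_mul]
    have hI : (C Complex.I : ℂ[X]) * C Complex.I = -1 := by rw [← C_mul]; simp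
    have h12 : (C (1 / 2) : ℂ[X]) * 2 = 1 := by
      rw [show (2 : ℂ[X]) = C 2 from rfl, ← C_mul]; norm_num
    set A : ℂ[X] := C (a j : ℂ)
    set B : ℂ[X] := C (b j : ℂ)
    set P := map Complex.ofRealHom (evenV (2 * m + 1) j)
    set Q := map Complex.ofRealHom (oddV (2 * m + 1) j)
    linear_combination (A * P - C Complex.I * C Complex.I * B * Q) * h12 - B * Q * hI
  have hall := zP_zbarP_independent _ c key
  have hcj : ∀ j : Fin (m + 1), a j = 0 ∧ b j = 0 := by
    intro j
    have h1 := hall j (by omega)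
    simp only [hc, if_pos j.2] at h1
    have h2 : (a j : ℂ) - Complex.I * b j = 0 := by
      simpa using h1
    have hre := congrArg Complex.re h2
    have him := congrArg Complex.im h2
    simp at hre him
    exact ⟨hre, him⟩
  rintro (j | j)
  · rw [← ha']; exact (hcj j).1
  · rw [← hb']; exact (hcj j).2

/-- The basis `V_{k,j}^{even}`, `V_{k,j}^{odd}`, `0 ≤ j ≤ m`, of `𝕍_k`, `k = 2m + 1`. -/
noncomputable def evenOddBasis (m : ℕ) :
    Module.Basis (Fin (m + 1) ⊕ Fin (m + 1)) ℝ (Fin (2 * m + 1 + 1) → ℝ) :=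
  basisOfLinearIndependentOfCardEqFinrank (linearIndependent_evenOddVec m) (by simp; omega)

/-- The complex form `ξ^{k,j} = ξ^{k,j}_{even} + i ξ^{k,j}_{odd}` on `𝕍_k`, where
`ξ^{k,j}_{even}, ξ^{k,j}_{odd}` is the basis dual to `V_{k,j}^{even}, V_{k,j}^{odd}`. -/
noncomputable def xiForm (m : ℕ) (j : Fin (m + 1)) (a : Fin (2 * m + 1 + 1) → ℝ) : ℂ :=
  ⟨(evenOddBasis m).repr a (Sum.inl j), (evenOddBasis m).repr a (Sum.inr j)⟩

end Polynomials

/-- The model fibre of a bundle of rank two. -/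
abbrev Plane : Type := Fin 2 → ℝ

section SymBasis
variable {V : Type*} [AddCommGroup V] [Module ℝ V]

/-- The element `x^(k-i) y^i` of the symmetric power `S^k(V)`. -/
noncomputable def symMonomial (k : ℕ) (x y : V) (i : Fin (k + 1)) : Sym[ℝ]^k V :=
  SymmetricPower.tprod ℝ fun s : Fin k => if (s : ℕ) < k - i then x else y

theorem tprod_choice_mem (k : ℕ) (x y : V) (c : Fin k → Fin 2) :
    ∃ i : Fin (k + 1), SymmetricPower.tprod ℝ (fun s => ![x, y] (c s)) = symMonomial k x y i := by
  classical
  set N := Fintype.card {s // c s = 0} with hN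
  have hNk : N ≤ k := by
    simpa using Fintype.card_subtype_le (fun s => c s = 0)
  refine ⟨⟨k - N, by omega⟩, ?_⟩
  set d : Fin k → Fin 2 := fun s => if (s : ℕ) < N then 0 else 1 with hd
  have hcard0 : Fintype.card {s // d s = 0} = N := by
    have : (Finset.univ.filter fun s : Fin k => d s = 0) =
        Finset.univ.filter fun s : Fin k => (s : ℕ) < N := by
      ext s; simp [hd]
    rw [Fintype.card_subtype, this, Fin.card_filter_val_lt]
    omega
  have hone : ∀ t : Fin 2, t = 1 ↔ ¬ t = 0 := by decide
  have hcard1 : Fintype.card {s // d s = 1} = Fintype.card {s // c s = 1} := by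
    rw [Fintype.card_congr (Equiv.subtypeEquivRight fun s => hone (d s)),
      Fintype.card_congr (Equiv.subtypeEquivRight fun s => hone (c s)),
      Fintype.card_subtype_compl, Fintype.card_subtype_compl, hcard0]
  have hfib : ∀ t : Fin 2, Nonempty ({s // d s = t} ≃ {s // c s = t}) := by
    intro t
    rw [← Fintype.card_eq]
    fin_cases t
    · exact hcard0
    · exact hcard1
  let e : Equiv.Perm (Fin k) := Equiv.ofFiberEquiv (f := d) (g := c) fun t => (hfib t).some
  have he : ∀ s, c (e s) = d s := fun s => Equiv.ofFiberEquiv_map _ s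
  rw [← SymmetricPower.tprod_equiv e]
  unfold symMonomial
  congr 1
  funext s
  have hkN : k - (k - N) = N := by omega
  simp only [he, hd, hkN]
  split_ifs <;> rfl

theorem span_symMonomial (k : ℕ) (b : Module.Basis (Fin 2) ℝ V) :
    Submodule.span ℝ (Set.range (symMonomial k (b 0) (b 1))) = ⊤ := by
  set S := Submodule.span ℝ (Set.range (symMonomial k (b 0) (b 1)))
  have hb : ∀ t, b t = ![b 0, b 1] t := by intro t; fin_cases t <;> rfl
  have h : S.mkQ.compMultilinearMap (SymmetricPower.tprod ℝ (ι := Fin k) (M := V)) = 0 := by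
    refine Module.Basis.ext_multilinear (fun _ => b) fun c => ?_
    obtain ⟨i, hi⟩ := tprod_choice_mem k (b 0) (b 1) c
    simp only [LinearMap.compMultilinearMap_apply, zero_apply,
      Submodule.mkQ_apply, Submodule.Quotient.mk_eq_zero]
    rw [show (fun s => b (c s)) = fun s => ![b 0, b 1] (c s) from funext fun s => hb _, hi]
    exact Submodule.subset_span ⟨i, rfl⟩
  rw [eq_top_iff, ← SymmetricPower.span_tprod_eq_top, Submodule.span_le]
  rintro _ ⟨f, rfl⟩
  have := congrArg (fun F => F f) h
  simpa [Submodule.Quotient.mk_eq_zero] using this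

end SymBasis

section Bundle
variable {n : ℕ} {M : Type*} [TopologicalSpace M]
  (E : M → Type*) [∀ p, AddCommGroup (E p)] [∀ p, Module ℝ (E p)] [∀ p, TopologicalSpace (E p)]
  [TopologicalSpace (TotalSpace Plane E)] [FiberBundle Plane E] [VectorBundle ℝ Plane E]

theorem linearIndependent_iff_det {V : Type*} [AddCommGroup V] [Module ℝ V] (L : V ≃ₗ[ℝ] Plane)
    (x y : V) :
    LinearIndependent ℝ ![x, y] ↔ L x 0 * L y 1 - L x 1 * L y 0 ≠ 0 := by
  rw [← LinearMap.linearIndependent_iff (L : V →ₗ[ℝ] Plane) (LinearEquiv.ker L)]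
  have : (⇑(L : V →ₗ[ℝ] Plane) ∘ ![x, y]) = Matrix.row (Matrix.of ![L x, L y]) := by
    funext i; fin_cases i <;> rfl
  rw [this, Matrix.linearIndependent_rows_iff_isUnit, Matrix.isUnit_iff_isUnit_det,
    Matrix.det_fin_two, isUnit_iff_ne_zero]
  simp

/-- The bundle of bases `(x, y)` of the fibres of `E`, an open subset of the total space of `E ⊕ E`.
For `b` in it, `b.1.1` is the base point and `b.1.2 = (x, y)`. -/
def frameBundle : TopologicalSpace.Opens (TotalSpace (Plane × Plane) (E ×ᵇ E)) where
  carrier := {b | LinearIndependent ℝ ![b.2.1, b.2.2]}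
  is_open' := by
    rw [isOpen_iff_mem_nhds]
    intro b hb
    let e := trivializationAt Plane E b.1
    let e2 := trivializationAt (Plane × Plane) (E ×ᵇ E) b.1
    have hbs : b.1 ∈ e.baseSet := mem_baseSet_trivializationAt Plane E b.1
    have key : ∀ c ∈ e2.source, (LinearIndependent ℝ ![c.2.1, c.2.2] ↔
        (e2 c).2.1 0 * (e2 c).2.2 1 - (e2 c).2.1 1 * (e2 c).2.2 0 ≠ 0) := by
      intro c hc
      have hc' : c.1 ∈ e.baseSet := (e2.mem_source.1 hc).1
      exact linearIndependent_iff_det (e.linearEquivAt ℝ c.1 hc') c.2.1 c.2.2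
    have hsrc : b ∈ e2.source := e2.mem_source.2 ⟨hbs, hbs⟩
    have hcont : ContinuousOn
        (fun c => (e2 c).2.1 0 * (e2 c).2.2 1 - (e2 c).2.1 1 * (e2 c).2.2 0) e2.source := by
      have h0 : ContinuousOn (fun c => (e2 c).2) e2.source :=
        continuous_snd.comp_continuousOn e2.continuousOn
      have h1 : Continuous fun v : Plane × Plane => v.1 0 * v.2 1 - v.1 1 * v.2 0 := by fun_prop
      exact h1.comp_continuousOn h0
    have hev := (hcont.continuousAt (e2.open_source.mem_nhds hsrc)).eventually_ne
      ((key b hsrc).1 hb)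
    filter_upwards [hev, e2.open_source.mem_nhds hsrc] with c hc hcs
    exact (key c hcs).2 hc

/-- The `GL(2)`-bundle `B(E)`: a frame `(x^k, x^(k-1) y, …, y^k)` of `TM` is given by a basis `(x, y)`
of a fibre of `E`, which it determines since `k` is odd in all that follows. -/
abbrev FrameBundle : Type _ := ↥(frameBundle E)

variable {E}

/-- The right action `(x, y) g = (g₀₀ x + g₁₀ y, g₀₁ x + g₁₁ y)` of `GL(2)` on `B(E)`. -/
def FrameBundle.act (b : FrameBundle E) (g : GL (Fin 2) ℝ) : FrameBundle E :=
  ⟨⟨b.1.1, (g 0 0 • b.1.2.1 + g 1 0 • b.1.2.2, g 0 1 • b.1.2.1 + g 1 1 • b.1.2.2)⟩, by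
    have hb : LinearIndependent ℝ ![b.1.2.1, b.1.2.2] := b.2
    have hg : (g : Matrix (Fin 2) (Fin 2) ℝ).det ≠ 0 := g.det_ne_zero
    rw [Matrix.det_fin_two] at hg
    change LinearIndependent ℝ ![_, _]
    rw [LinearIndependent.pair_iff] at hb ⊢
    intro s t hst
    obtain ⟨h1, h2⟩ := hb (s * g 0 0 + t * g 0 1) (s * g 1 0 + t * g 1 1) (by
      rw [← hst]; module)
    constructor
    · refine (mul_eq_zero.1 (?_ : s * (g 0 0 * g 1 1 - g 0 1 * g 1 0) = 0)).resolve_right hg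
      linear_combination g 1 1 * h1 - g 0 1 * h2
    · refine (mul_eq_zero.1 (?_ : t * (g 0 0 * g 1 1 - g 0 1 * g 1 0) = 0)).resolve_right hg
      linear_combination g 0 0 * h2 - g 1 0 * h1⟩

theorem FrameBundle.act_one (b : FrameBundle E) : b.act 1 = b := by
  apply Subtype.ext
  obtain ⟨⟨p, x, y⟩, hb⟩ := b
  simp [FrameBundle.act]

theorem FrameBundle.act_act (b : FrameBundle E) (g h : GL (Fin 2) ℝ) :
    (b.act g).act h = b.act (g * h) := by
  apply Subtype.ext
  obtain ⟨⟨p, x, y⟩, hb⟩ := b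
  simp only [FrameBundle.act, Units.val_mul, Matrix.mul_apply, Fin.sum_univ_two]
  refine congrArg (TotalSpace.mk p) (Prod.ext ?_ ?_)
  · change h 0 0 • (g 0 0 • x + g 1 0 • y) + h 1 0 • (g 0 1 • x + g 1 1 • y) =
      (g 0 0 * h 0 0 + g 0 1 * h 1 0) • x + (g 1 0 * h 0 0 + g 1 1 * h 1 0) • y
    module
  · change h 0 1 • (g 0 0 • x + g 1 0 • y) + h 1 1 • (g 0 1 • x + g 1 1 • y) =
      (g 0 0 * h 0 1 + g 0 1 * h 1 1) • x + (g 1 0 * h 0 1 + g 1 1 * h 1 1) • y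
    module

/-- The subgroup `CO(2)` of the matrices `(u, -v; v, u)`. -/
def CO2 : Subgroup (GL (Fin 2) ℝ) where
  carrier := {g | g 0 0 = g 1 1 ∧ g 0 1 = -g 1 0}
  one_mem' := by simp
  mul_mem' := by
    rintro g h ⟨h1, h2⟩ ⟨h3, h4⟩
    simp only [Set.mem_ofPred_eq, Units.val_mul, Matrix.mul_apply, Fin.sum_univ_two] at *
    rw [h1, h2, h3, h4]
    constructor <;> ring
  inv_mem' := by
    rintro g ⟨h1, h2⟩
    simp only [Set.mem_ofPred_eq, Matrix.coe_units_inv, Matrix.inv_def, Matrix.adjugate_fin_two,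
      Matrix.smul_apply, smul_eq_mul] at *
    simp [h1, h2]

variable (E) in
/-- The orbit relation of `CO(2)` on `B(E)`. -/
def co2Setoid : Setoid (FrameBundle E) where
  r b b' := ∃ g ∈ CO2, b' = b.act g
  iseqv := by
    refine ⟨fun b => ⟨1, CO2.one_mem, b.act_one.symm⟩, ?_, ?_⟩
    · rintro b b' ⟨g, hg, rfl⟩
      exact ⟨g⁻¹, CO2.inv_mem hg, by rw [b.act_act, mul_inv_cancel, b.act_one]⟩
    · rintro b b' b'' ⟨g, hg, rfl⟩ ⟨h, hh, rfl⟩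
      exact ⟨g * h, CO2.mul_mem hg hh, b.act_act g h⟩

variable (E) in
/-- The quotient bundle `B(E)/CO(2)`, with the quotient topology. -/
def ConfFrame : Type _ := Quotient (co2Setoid E)

instance : TopologicalSpace (ConfFrame E) := inferInstanceAs (TopologicalSpace (Quotient _))

/-- The quotient map `B(E) → B(E)/CO(2)`. -/
def ConfFrame.mk (b : FrameBundle E) : ConfFrame E := Quotient.mk (co2Setoid E) b

theorem ConfFrame.continuous_mk : Continuous (ConfFrame.mk (E := E)) := continuous_quotient_mk'

theorem ConfFrame.mk_eq_mk {b b' : FrameBundle E} :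
    ConfFrame.mk b = ConfFrame.mk b' ↔ ∃ g ∈ CO2, b' = b.act g :=
  Quotient.eq (r := co2Setoid E)

/-- The projection `B(E)/CO(2) → M`. -/
def ConfFrame.proj : ConfFrame E → M :=
  Quotient.lift (fun b => b.1.1) (by rintro b _ ⟨g, _, rfl⟩; rfl)

@[simp] theorem ConfFrame.proj_mk (b : FrameBundle E) : (ConfFrame.mk b).proj = b.1.1 := rfl

theorem FrameBundle.continuous_base : Continuous (fun b : FrameBundle E => b.1.1) :=
  (FiberBundle.continuous_proj (Plane × Plane) (E ×ᵇ E)).comp continuous_subtype_val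

theorem ConfFrame.continuous_proj : Continuous (ConfFrame.proj (E := E)) :=
  FrameBundle.continuous_base.quotient_lift _

/-- The `i`-th coordinate of `z = x + i y` in the local frame of `E` around `p₀`. -/
noncomputable def FrameBundle.zCoord (p₀ : M) (b : FrameBundle E) (i : Fin 2) : ℂ :=
  ⟨(trivializationAt Plane E p₀).linearMapAt ℝ b.1.1 b.1.2.1 i,
    (trivializationAt Plane E p₀).linearMapAt ℝ b.1.1 b.1.2.2 i⟩


theorem FrameBundle.zCoord_act (p₀ : M) (b : FrameBundle E) {g : GL (Fin 2) ℝ} (hg : g ∈ CO2)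
    (i : Fin 2) :
    (b.act g).zCoord p₀ i = (⟨g 0 0, -g 1 0⟩ : ℂ) * b.zCoord p₀ i := by
  obtain ⟨h1, h2⟩ := hg
  obtain ⟨⟨p, x, y⟩, hmem⟩ := b
  set L : E p →ₗ[ℝ] Plane := (trivializationAt Plane E p₀).linearMapAt ℝ p
  apply Complex.ext
  · change L (g 0 0 • x + g 1 0 • y) i = g 0 0 * L x i - -g 1 0 * L y i
    simp
  · change L (g 0 1 • x + g 1 1 • y) i = g 0 0 * L y i + -g 1 0 * L x i
    simp [h1, h2]
    ring

theorem CO2.complex_ne_zero {g : GL (Fin 2) ℝ} (hg : g ∈ CO2) : (⟨g 0 0, -g 1 0⟩ : ℂ) ≠ 0 := by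
  obtain ⟨h1, h2⟩ := hg
  intro h
  have hd : (g : Matrix (Fin 2) (Fin 2) ℝ).det ≠ 0 := g.det_ne_zero
  rw [Matrix.det_fin_two] at hd
  have h3 := congrArg Complex.re h
  have h4 := congrArg Complex.im h
  simp at h3 h4
  apply hd
  simp [h3, h4]

theorem FrameBundle.zCoord_det (p₀ : M) (b : FrameBundle E)
    (hb : b.1.1 ∈ (trivializationAt Plane E p₀).baseSet) :
    (b.zCoord p₀ 0).re * (b.zCoord p₀ 1).im - (b.zCoord p₀ 1).re * (b.zCoord p₀ 0).im ≠ 0 := by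
  have := (linearIndependent_iff_det ((trivializationAt Plane E p₀).linearEquivAt ℝ b.1.1 hb)
    b.1.2.1 b.1.2.2).1 b.2
  simpa [FrameBundle.zCoord, Trivialization.linearMapAt_apply, hb] using this

theorem FrameBundle.zCoord_ne_zero (p₀ : M) (b : FrameBundle E)
    (hb : b.1.1 ∈ (trivializationAt Plane E p₀).baseSet) : b.zCoord p₀ 0 ≠ 0 := by
  intro h
  apply b.zCoord_det p₀ hb
  simp [h]

/-- The coordinate `w = z₁ / z₀`, with values in `ℂ ∖ ℝ`, on the fibres of `B(E)/CO(2)`. -/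
noncomputable def ConfFrame.wCoord (p₀ : M) : ConfFrame E → ℂ :=
  Quotient.lift (fun b => b.zCoord p₀ 1 / b.zCoord p₀ 0) (by
    rintro b _ ⟨g, hg, rfl⟩
    simp only [b.zCoord_act p₀ hg]
    rw [mul_div_mul_left _ _ (CO2.complex_ne_zero hg)])

@[simp] theorem ConfFrame.wCoord_mk (p₀ : M) (b : FrameBundle E) :
    (ConfFrame.mk b).wCoord p₀ = b.zCoord p₀ 1 / b.zCoord p₀ 0 := rfl

theorem FrameBundle.w_im_ne_zero (p₀ : M) (b : FrameBundle E)
    (hb : b.1.1 ∈ (trivializationAt Plane E p₀).baseSet) :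
    (b.zCoord p₀ 1 / b.zCoord p₀ 0).im ≠ 0 := by
  have h0 := b.zCoord_ne_zero p₀ hb
  have hn : Complex.normSq (b.zCoord p₀ 0) ≠ 0 := by simpa using h0
  rw [Complex.div_im, ← sub_div]
  refine div_ne_zero ?_ hn
  have := b.zCoord_det p₀ hb
  intro h
  apply this
  linear_combination h

/-- The basis `(x, y)` with `x + i y = e₀ + w e₁`, for the local frame `e₀, e₁` around `p₀`. -/
noncomputable def frameOfW (p₀ : M) (p : M) (w : ℂ) : TotalSpace (Plane × Plane) (E ×ᵇ E) :=
  ⟨p, ((trivializationAt Plane E p₀).symm p ![1, w.re],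
    (trivializationAt Plane E p₀).symm p ![0, w.im])⟩

theorem frameOfW_mem (p₀ p : M) (w : ℂ) (hp : p ∈ (trivializationAt Plane E p₀).baseSet)
    (hw : w.im ≠ 0) : frameOfW (E := E) p₀ p w ∈ frameBundle E := by
  refine (linearIndependent_iff_det ((trivializationAt Plane E p₀).linearEquivAt ℝ p hp) _ _).2 ?_
  simpa [frameOfW, hp] using hw

theorem continuousOn_frameOfW (p₀ : M) :
    ContinuousOn (fun q : M × ℂ => frameOfW (E := E) p₀ q.1 q.2)
      ((trivializationAt Plane E p₀).baseSet ×ˢ Set.univ) := by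
  let e := trivializationAt Plane E p₀
  have h1 : Continuous fun q : M × ℂ => (q.1, ((![1, q.2.re], ![0, q.2.im]) : Plane × Plane)) := by
    fun_prop
  refine ((e.prod e).toOpenPartialHomeomorph.continuousOn_symm).comp h1.continuousOn ?_
  rintro q hq
  exact ⟨⟨hq.1, hq.1⟩, trivial⟩

theorem zCoord_frameOfW (p₀ p : M) (w : ℂ) (hp : p ∈ (trivializationAt Plane E p₀).baseSet)
    (h : frameOfW (E := E) p₀ p w ∈ frameBundle E) :
    FrameBundle.zCoord (E := E) p₀ ⟨frameOfW p₀ p w, h⟩ = ![1, w] := by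
  have hL : ∀ v : Plane, (trivializationAt Plane E p₀).linearMapAt ℝ p
      ((trivializationAt Plane E p₀).symm p v) = v := fun v =>
    (trivializationAt Plane E p₀).linearMapAt_symm hp v
  funext i
  change (⟨(trivializationAt Plane E p₀).linearMapAt ℝ p
      ((trivializationAt Plane E p₀).symm p ![1, w.re]) i,
    (trivializationAt Plane E p₀).linearMapAt ℝ p
      ((trivializationAt Plane E p₀).symm p ![0, w.im]) i⟩ : ℂ) = _
  rw [hL, hL]
  fin_cases i <;> apply Complex.ext <;> simp

theorem mk_frameOfW (p₀ : M) (b : FrameBundle E)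
    (hb : b.1.1 ∈ (trivializationAt Plane E p₀).baseSet)
    (h : frameOfW (E := E) p₀ b.1.1 (b.zCoord p₀ 1 / b.zCoord p₀ 0) ∈ frameBundle E) :
    ConfFrame.mk ⟨frameOfW p₀ b.1.1 (b.zCoord p₀ 1 / b.zCoord p₀ 0), h⟩ = ConfFrame.mk b := by
  set w := b.zCoord p₀ 1 / b.zCoord p₀ 0 with hw
  have h0 := b.zCoord_ne_zero p₀ hb
  set a := b.zCoord p₀ 0 with ha
  let A : Matrix (Fin 2) (Fin 2) ℝ := !![a.re, a.im; -a.im, a.re]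
  have hA : A.det ≠ 0 := by
    rw [Matrix.det_fin_two_of]
    have : Complex.normSq a ≠ 0 := by simpa using h0
    rw [Complex.normSq_apply] at this
    intro h; apply this; linear_combination h
  have hz1 : b.zCoord p₀ 1 = a * w := by rw [hw]; field_simp
  refine ConfFrame.mk_eq_mk.2
    ⟨Matrix.GeneralLinearGroup.mkOfDetNeZero A hA, ⟨by simp [A], by simp [A]⟩, ?_⟩
  apply Subtype.ext
  obtain ⟨⟨p, x, y⟩, hmem⟩ := b
  set e := trivializationAt Plane E p₀
  change p ∈ e.baseSet at hb
  have hL : ∀ v : Plane, e.linearMapAt ℝ p (e.symm p v) = v := fun v => e.linearMapAt_symm hb v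
  have hinj : Function.Injective (e.linearMapAt ℝ p) :=
    Function.LeftInverse.injective (g := e.symm p) fun v => e.symm_linearMapAt hb v
  have hx : ∀ i, e.linearMapAt ℝ p x i = ((![a, a * w] : Fin 2 → ℂ) i).re := by
    intro i
    fin_cases i
    · rfl
    · exact congrArg Complex.re hz1
  have hy : ∀ i, e.linearMapAt ℝ p y i = ((![a, a * w] : Fin 2 → ℂ) i).im := by
    intro i
    fin_cases i
    · rfl
    · exact congrArg Complex.im hz1
  refine congrArg (TotalSpace.mk p) (Prod.ext ?_ ?_)
  · apply hinj
    change e.linearMapAt ℝ p x =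
      e.linearMapAt ℝ p (a.re • e.symm p ![1, w.re] + -a.im • e.symm p ![0, w.im])
    rw [map_add, map_smul, map_smul, hL, hL]
    funext i
    rw [hx]
    fin_cases i <;> simp; ring
  · apply hinj
    change e.linearMapAt ℝ p y =
      e.linearMapAt ℝ p (a.im • e.symm p ![1, w.re] + a.re • e.symm p ![0, w.im])
    rw [map_add, map_smul, map_smul, hL, hL]
    funext i
    rw [hy]
    fin_cases i <;> simp; ring

theorem ConfFrame.continuousOn_wCoord (p₀ : M) :
    ContinuousOn (ConfFrame.wCoord (E := E) p₀)
      (ConfFrame.proj ⁻¹' (trivializationAt Plane E p₀).baseSet) := by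
  set e := trivializationAt Plane E p₀
  have ho : IsOpen (ConfFrame.proj (E := E) ⁻¹' e.baseSet) :=
    e.open_baseSet.preimage ConfFrame.continuous_proj
  have hq : Topology.IsQuotientMap (ConfFrame.mk (E := E)) := isQuotientMap_quotient_mk'
  refine (hq.continuousOn_isOpen_iff (g := ConfFrame.wCoord (E := E) p₀) ho).2 ?_
  have hz : ∀ i, ContinuousOn (fun b : FrameBundle E => b.zCoord p₀ i)
      ((fun b : FrameBundle E => b.1.1) ⁻¹' e.baseSet) := by
    intro i
    have h1 : ContinuousOn (fun b : FrameBundle E => (e.prod e b.1).2)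
        ((fun b : FrameBundle E => b.1.1) ⁻¹' e.baseSet) :=
      continuous_snd.comp_continuousOn ((e.prod e).continuousOn.comp
        continuous_subtype_val.continuousOn fun b hb => ⟨hb, hb⟩)
    have h2 : Continuous fun v : Plane × Plane => (v.1 i : ℂ) + v.2 i * Complex.I := by fun_prop
    refine (h2.comp_continuousOn h1).congr fun b hb => ?_
    have hb' : b.1.1 ∈ e.baseSet := hb
    have hL : ∀ v : E b.1.1, e.linearMapAt ℝ b.1.1 v = (e ⟨b.1.1, v⟩).2 := fun v => by
      rw [e.linearMapAt_apply, if_pos hb']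
    change (⟨e.linearMapAt ℝ b.1.1 b.1.2.1 i, e.linearMapAt ℝ b.1.1 b.1.2.2 i⟩ : ℂ) =
      ((e ⟨b.1.1, b.1.2.1⟩).2 i : ℂ) + ((e ⟨b.1.1, b.1.2.2⟩).2 i : ℂ) * Complex.I
    rw [hL, hL, Complex.mk_eq_add_mul_I]
  exact (hz 1).div (hz 0) fun b hb => b.zCoord_ne_zero p₀ hb

end Bundle

section Charts
variable {n : ℕ} {M : Type*} [TopologicalSpace M] [ChartedSpace (EuclideanSpace ℝ (Fin n)) M]
  {E : M → Type*} [∀ p, AddCommGroup (E p)] [∀ p, Module ℝ (E p)] [∀ p, TopologicalSpace (E p)]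
  [TopologicalSpace (TotalSpace Plane E)] [FiberBundle Plane E] [VectorBundle ℝ Plane E]

open Classical in
/-- The chart of `B(E)/CO(2)` at `χ`: a chart of `M` and the fibre coordinate `w`. -/
noncomputable def ConfFrame.chart (χ : ConfFrame E) :
    OpenPartialHomeomorph (ConfFrame E) (EuclideanSpace ℝ (Fin n) × ℂ) where
  toFun ψ := (chartAt (EuclideanSpace ℝ (Fin n)) χ.proj ψ.proj, ψ.wCoord χ.proj)
  invFun q :=
    if h : frameOfW (E := E) χ.proj ((chartAt (EuclideanSpace ℝ (Fin n)) χ.proj).symm q.1) q.2 ∈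
      frameBundle E then .mk ⟨_, h⟩ else χ
  source := ConfFrame.proj ⁻¹' ((chartAt (EuclideanSpace ℝ (Fin n)) χ.proj).source ∩
    (trivializationAt Plane E χ.proj).baseSet)
  target := (((chartAt (EuclideanSpace ℝ (Fin n)) χ.proj).symm.source ∩
    (chartAt (EuclideanSpace ℝ (Fin n)) χ.proj).symm ⁻¹'
      (trivializationAt Plane E χ.proj).baseSet)) ×ˢ {w | w.im ≠ 0}
  map_source' := by
    intro ψ
    induction ψ using Quotient.inductionOn with | _ b =>
    rintro ⟨h1, h2⟩
    change b.1.1 ∈ (chartAt (EuclideanSpace ℝ (Fin n)) χ.proj).source at h1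
    change b.1.1 ∈ (trivializationAt Plane E χ.proj).baseSet at h2
    refine ⟨⟨(chartAt (EuclideanSpace ℝ (Fin n)) χ.proj).map_source h1, ?_⟩, b.w_im_ne_zero χ.proj h2⟩
    change (chartAt (EuclideanSpace ℝ (Fin n)) χ.proj).symm
      ((chartAt (EuclideanSpace ℝ (Fin n)) χ.proj) b.1.1) ∈
        (trivializationAt Plane E χ.proj).baseSet
    rwa [(chartAt (EuclideanSpace ℝ (Fin n)) χ.proj).left_inv h1]
  map_target' := by
    rintro ⟨u, w⟩ ⟨⟨h1, h2⟩, h3⟩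
    have h4 := frameOfW_mem (E := E) _ _ _ h2 h3
    dsimp only
    rw [dif_pos h4]
    exact ⟨(chartAt (EuclideanSpace ℝ (Fin n)) χ.proj).map_target h1, h2⟩
  left_inv' := by
    intro ψ
    induction ψ using Quotient.inductionOn with | _ b =>
    rintro ⟨h1, h2⟩
    change b.1.1 ∈ (chartAt (EuclideanSpace ℝ (Fin n)) χ.proj).source at h1
    change b.1.1 ∈ (trivializationAt Plane E χ.proj).baseSet at h2
    have h3 := b.w_im_ne_zero χ.proj h2
    have e : (chartAt (EuclideanSpace ℝ (Fin n)) χ.proj).symm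
      ((chartAt (EuclideanSpace ℝ (Fin n)) χ.proj) b.1.1) = b.1.1 :=
        (chartAt (EuclideanSpace ℝ (Fin n)) χ.proj).left_inv h1
    have h4 : frameOfW (E := E) χ.proj b.1.1 (b.zCoord χ.proj 1 / b.zCoord χ.proj 0) ∈
      frameBundle E := frameOfW_mem _ _ _ h2 h3
    have := mk_frameOfW χ.proj b h2 h4
    change (if h : frameOfW (E := E) χ.proj ((chartAt (EuclideanSpace ℝ (Fin n)) χ.proj).symm
      ((chartAt (EuclideanSpace ℝ (Fin n)) χ.proj) b.1.1))
      (b.zCoord χ.proj 1 / b.zCoord χ.proj 0) ∈ frameBundle E then ConfFrame.mk ⟨_, h⟩ else χ) =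
        ConfFrame.mk b
    simp only [e]
    rw [dif_pos h4, this]
  right_inv' := by
    rintro ⟨u, w⟩ ⟨⟨h1, h2⟩, h3⟩
    have h4 := frameOfW_mem (E := E) _ _ _ h2 h3
    dsimp only
    rw [dif_pos h4]
    refine Prod.ext ?_ ?_
    · exact (chartAt (EuclideanSpace ℝ (Fin n)) χ.proj).right_inv h1
    · rw [ConfFrame.wCoord_mk, zCoord_frameOfW _ _ _ h2]
      simp
  open_source := (((chartAt (EuclideanSpace ℝ (Fin n)) χ.proj).open_source.inter
    (trivializationAt Plane E χ.proj).open_baseSet)).preimage ConfFrame.continuous_proj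
  open_target := by
    refine IsOpen.prod ?_ ?_
    · exact (chartAt (EuclideanSpace ℝ (Fin n)) χ.proj).symm.isOpen_inter_preimage
        (trivializationAt Plane E χ.proj).open_baseSet
    · exact isOpen_ne.preimage Complex.continuous_im
  continuousOn_toFun :=
    ((chartAt (EuclideanSpace ℝ (Fin n)) χ.proj).continuousOn.comp
      ConfFrame.continuous_proj.continuousOn fun _ h => h.1).prodMk
      ((ConfFrame.continuousOn_wCoord χ.proj).mono fun _ h => h.2)
  continuousOn_invFun := by
    have h1 : ContinuousOn (fun q : EuclideanSpace ℝ (Fin n) × ℂ => frameOfW (E := E) χ.proj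
        ((chartAt (EuclideanSpace ℝ (Fin n)) χ.proj).symm q.1) q.2)
        ((((chartAt (EuclideanSpace ℝ (Fin n)) χ.proj).symm.source ∩
          (chartAt (EuclideanSpace ℝ (Fin n)) χ.proj).symm ⁻¹'
          (trivializationAt Plane E χ.proj).baseSet)) ×ˢ {w | w.im ≠ 0}) := by
      refine (continuousOn_frameOfW (E := E) χ.proj).comp
        (f := fun q : EuclideanSpace ℝ (Fin n) × ℂ =>
          ((chartAt (EuclideanSpace ℝ (Fin n)) χ.proj).symm q.1, q.2)) ?_ ?_
      · exact ((chartAt (EuclideanSpace ℝ (Fin n)) χ.proj).continuousOn_symm.comp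
          continuousOn_fst fun q hq => hq.1.1).prodMk continuousOn_snd
      · exact fun q hq => ⟨hq.1.2, trivial⟩
    rw [continuousOn_iff_continuous_domRestrict] at h1 ⊢
    refine (ConfFrame.continuous_mk.comp
      (h1.codRestrict fun q => frameOfW_mem _ _ _ q.2.1.2 q.2.2)).congr fun q => ?_
    simp only [Set.domRestrict_apply]
    rw [dif_pos (frameOfW_mem _ _ _ q.2.1.2 q.2.2)]
    rfl

/-- The manifold structure of `B(E)/CO(2)`. -/
noncomputable instance : ChartedSpace (EuclideanSpace ℝ (Fin n) × ℂ) (ConfFrame E) where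
  atlas := Set.range ConfFrame.chart
  chartAt := ConfFrame.chart
  mem_chart_source χ := ⟨mem_chart_source (EuclideanSpace ℝ (Fin n)) χ.proj, mem_baseSet_trivializationAt Plane E χ.proj⟩
  chart_mem_atlas χ := ⟨χ, rfl⟩

instance [ContMDiffVectorBundle ∞ Plane E (𝓡 n)] [IsManifold (𝓡 n) ∞ M] :
    IsManifold 𝓘(ℝ, EuclideanSpace ℝ (Fin n) × ℂ) ∞ (ConfFrame E) := by
  refine isManifold_of_contDiffOn _ _ _ ?_
  rintro _ _ ⟨χ, rfl⟩ ⟨ψ, rfl⟩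
  set c := chartAt (EuclideanSpace ℝ (Fin n)) χ.proj with hc
  set d := chartAt (EuclideanSpace ℝ (Fin n)) ψ.proj with hd
  set e := trivializationAt Plane E χ.proj with he
  set f := trivializationAt Plane E ψ.proj with hf
  set A : M → Plane → Plane := fun p v => e.coordChangeL ℝ f p v with hA
  set S : Set (EuclideanSpace ℝ (Fin n) × ℂ) := {q | (q.1 ∈ c.target ∧ c.symm q.1 ∈ e.baseSet) ∧
    q.2.im ≠ 0 ∧ c.symm q.1 ∈ d.source ∧ c.symm q.1 ∈ f.baseSet} with hS
  set Z : Fin 2 → EuclideanSpace ℝ (Fin n) × ℂ → ℂ := fun i q =>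
    (A (c.symm q.1) ![1, 0] i : ℂ) + (A (c.symm q.1) ![0, 1] i : ℂ) * q.2 with hZ
  have hZb : ∀ q ∈ S, ∀ (h : frameOfW (E := E) χ.proj (c.symm q.1) q.2 ∈ frameBundle E) (i : Fin 2),
      FrameBundle.zCoord ψ.proj ⟨_, h⟩ i = Z i q := by
    rintro q ⟨⟨h1, h2⟩, h3, h4, h5⟩ h i
    have hL : ∀ v : Plane, f.linearMapAt ℝ (c.symm q.1) (e.symm (c.symm q.1) v) =
        A (c.symm q.1) v := fun v => by
      rw [f.linearMapAt_apply, if_pos h5]; exact (e.coordChangeL_apply f ⟨h2, h5⟩ v).symm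
    change (⟨f.linearMapAt ℝ (c.symm q.1) (e.symm (c.symm q.1) ![1, q.2.re]) i,
      f.linearMapAt ℝ (c.symm q.1) (e.symm (c.symm q.1) ![0, q.2.im]) i⟩ : ℂ) = _
    have h6 : A (c.symm q.1) ![1, q.2.re] =
        A (c.symm q.1) ![1, 0] + q.2.re • A (c.symm q.1) ![0, 1] := by
      simp only [hA, ← map_smul, ← map_add]
      congr 1
      funext i; fin_cases i <;> simp
    have h7 : A (c.symm q.1) ![0, q.2.im] = q.2.im • A (c.symm q.1) ![0, 1] := by
      simp only [hA, ← map_smul]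
      congr 1
      funext i; fin_cases i <;> simp
    rw [hL, hL, h6, h7]
    apply Complex.ext <;> simp [hZ, mul_comm]
  have hfr : ∀ q ∈ S, frameOfW (E := E) χ.proj (c.symm q.1) q.2 ∈ frameBundle E :=
    fun q hq => frameOfW_mem _ _ _ hq.1.2 hq.2.1
  have hbase : ContMDiffOn 𝓘(ℝ, EuclideanSpace ℝ (Fin n) × ℂ) (𝓡 n) ∞
      (fun q : EuclideanSpace ℝ (Fin n) × ℂ => c.symm q.1) S := by
    have h1 : ContMDiffOn (𝓡 n) (𝓡 n) ∞ c.symm c.target := contMDiffOn_chart_symm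
    have h2 : ContMDiffOn 𝓘(ℝ, EuclideanSpace ℝ (Fin n) × ℂ) (𝓡 n) ∞
        (fun q : EuclideanSpace ℝ (Fin n) × ℂ => q.1) S :=
      contMDiffOn_iff_contDiffOn.2 contDiff_fst.contDiffOn
    exact h1.comp h2 fun q hq => hq.1.1
  have hAs : ∀ v i, ContDiffOn ℝ ∞ (fun q => (A (c.symm q.1) v i : ℂ)) S := by
    intro v i
    have h1 : ContMDiffOn (𝓡 n) 𝓘(ℝ, Plane) ∞ (fun p => A p v) (e.baseSet ∩ f.baseSet) :=
      (contMDiffOn_coordChangeL (n := ∞) (IB := 𝓡 n) e f).clm_apply contMDiffOn_const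
    have h2 : ContDiffOn ℝ ∞ (fun q => A (c.symm q.1) v) S :=
      contMDiffOn_iff_contDiffOn.1 (h1.comp hbase fun q hq => ⟨hq.1.2, hq.2.2.2⟩)
    exact Complex.ofRealCLM.contDiff.comp_contDiffOn (contDiffOn_pi.1 h2 i)
  have hZs : ∀ i, ContDiffOn ℝ ∞ (Z i) S := fun i =>
    (hAs _ i).add ((hAs _ i).mul contDiff_snd.contDiffOn)
  have hT : ContDiffOn ℝ ∞ (fun q => (d (c.symm q.1), Z 1 q * (Z 0 q)⁻¹)) S := by
    refine ContDiffOn.prodMk ?_ ((hZs 1).mul ((hZs 0).inv fun q hq => ?_))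
    · have h1 : ContMDiffOn (𝓡 n) (𝓡 n) ∞ d d.source := contMDiffOn_chart
      exact contMDiffOn_iff_contDiffOn.1 (h1.comp hbase fun q hq => hq.2.2.1)
    · rw [← hZb q hq (hfr q hq)]
      exact FrameBundle.zCoord_ne_zero _ _ hq.2.2.2
  have hsrc : ∀ q ∈ ((ConfFrame.chart (n := n) χ).symm ≫ₕ ConfFrame.chart (n := n) ψ).source,
      ∃ h : frameOfW (E := E) χ.proj (c.symm q.1) q.2 ∈ frameBundle E, q ∈ S ∧
        (ConfFrame.chart (n := n) χ).symm q = ConfFrame.mk ⟨_, h⟩ := by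
    rintro q ⟨⟨⟨h1, h2⟩, h3⟩, h4⟩
    have h := frameOfW_mem (E := E) _ _ _ h2 h3
    have h5 : (ConfFrame.chart (n := n) χ).symm q = ConfFrame.mk ⟨_, h⟩ := dif_pos h
    change (ConfFrame.chart (n := n) χ).symm q ∈ (ConfFrame.chart (n := n) ψ).source at h4
    rw [h5] at h4
    exact ⟨h, ⟨⟨h1, h2⟩, h3, h4.1, h4.2⟩, h5⟩
  refine (hT.mono fun q hq => (hsrc q hq.1).choose_spec.1).congr fun q hq => ?_
  obtain ⟨h, hqS, h5⟩ := hsrc q hq.1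
  change (ConfFrame.chart (n := n) ψ) ((ConfFrame.chart (n := n) χ).symm q) = _
  rw [h5, ← hZb q hqS h 0, ← hZb q hqS h 1]
  rfl

theorem one_tmul_add_I_tmul_injective {V : Type*} [AddCommGroup V] [Module ℝ V] {x y x' y' : V}
    (h : (1 : ℂ) ⊗ₜ[ℝ] x + Complex.I ⊗ₜ[ℝ] y = (1 : ℂ) ⊗ₜ[ℝ] x' + Complex.I ⊗ₜ[ℝ] y') :
    x = x' ∧ y = y' := by
  have hre := congrArg (TensorProduct.lid ℝ V ∘ Complex.reLm.rTensor V) h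
  have him := congrArg (TensorProduct.lid ℝ V ∘ Complex.imLm.rTensor V) h
  simpa using And.intro hre him

end Charts
section Complexification
variable {M : Type*} [TopologicalSpace M]
  (E : M → Type*) [∀ p, AddCommGroup (E p)] [∀ p, Module ℝ (E p)] [∀ p, TopologicalSpace (E p)]
  [TopologicalSpace (TotalSpace Plane E)] [FiberBundle Plane E] [VectorBundle ℝ Plane E]

/-- The set `P(E^ℂ) ∖ P(E)`: pairs of `p : M` and a complex line in `E_p^ℂ = ℂ ⊗ E_p` which is not
spanned by a real vector. -/
def NonrealLine : Type _ :=
  {l : Σ p, Projectivization ℂ (ℂ ⊗[ℝ] E p) //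
    ∀ (e : E l.1) (h : (1 : ℂ) ⊗ₜ[ℝ] e ≠ 0), l.2 ≠ Projectivization.mk ℂ _ h}

variable {E}

/-- The vector `z = x + i y` of `E_p^ℂ` for `b = (x, y)`. -/
noncomputable def FrameBundle.zVec (b : FrameBundle E) : ℂ ⊗[ℝ] E b.1.1 :=
  (1 : ℂ) ⊗ₜ[ℝ] b.1.2.1 + Complex.I ⊗ₜ[ℝ] b.1.2.2

theorem FrameBundle.zVec_ne (b : FrameBundle E) (c : ℂ) (e : E b.1.1) :
    b.zVec ≠ c • ((1 : ℂ) ⊗ₜ[ℝ] e) := by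
  intro h
  have h1 : c • ((1 : ℂ) ⊗ₜ[ℝ] e) =
      (1 : ℂ) ⊗ₜ[ℝ] (c.re • e) + Complex.I ⊗ₜ[ℝ] (c.im • e) := by
    rw [TensorProduct.tmul_smul, TensorProduct.tmul_smul, TensorProduct.smul_tmul',
      TensorProduct.smul_tmul', TensorProduct.smul_tmul', ← TensorProduct.add_tmul]
    congr 1
    apply Complex.ext <;> simp
  rw [h1] at h
  obtain ⟨hx, hy⟩ := one_tmul_add_I_tmul_injective h
  have hb : LinearIndependent ℝ ![b.1.2.1, b.1.2.2] := b.2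
  rw [LinearIndependent.pair_iff] at hb
  have h2 := hb c.im (-c.re) (by rw [hx, hy]; module)
  have h3 := hb 1 0 (by rw [hx, show c.re = 0 by linarith [h2.2]]; simp)
  exact one_ne_zero h3.1

theorem FrameBundle.zVec_ne_zero (b : FrameBundle E) : b.zVec ≠ 0 := by
  simpa using b.zVec_ne 0 0

theorem FrameBundle.zVec_act (b : FrameBundle E) {g : GL (Fin 2) ℝ} (hg : g ∈ CO2) :
    (b.act g).zVec = (⟨g 0 0, -g 1 0⟩ : ℂ) • b.zVec := by
  obtain ⟨⟨p, x, y⟩, hmem⟩ := b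
  obtain ⟨h1, h2⟩ := hg
  change (1 : ℂ) ⊗ₜ[ℝ] (g 0 0 • x + g 1 0 • y) + Complex.I ⊗ₜ[ℝ] (g 0 1 • x + g 1 1 • y) =
    (⟨g 0 0, -g 1 0⟩ : ℂ) • ((1 : ℂ) ⊗ₜ[ℝ] x + Complex.I ⊗ₜ[ℝ] y)
  have e1 : (⟨g 0 0, -g 1 0⟩ : ℂ) = g 0 0 • (1 : ℂ) + g 0 1 • Complex.I := by
    apply Complex.ext <;> simp [h2]
  have e2 : (⟨g 0 0, -g 1 0⟩ : ℂ) * Complex.I = g 1 0 • (1 : ℂ) + g 1 1 • Complex.I := by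
    apply Complex.ext <;> simp [h1]
  rw [smul_add, TensorProduct.smul_tmul', TensorProduct.smul_tmul', smul_eq_mul, smul_eq_mul,
    mul_one, e2, e1]
  simp only [TensorProduct.tmul_add, TensorProduct.add_tmul, TensorProduct.tmul_smul,
    TensorProduct.smul_tmul']
  abel

/-- The point `[x + i y]` of `P(E^ℂ) ∖ P(E)`. -/
noncomputable def FrameBundle.line (b : FrameBundle E) : NonrealLine E :=
  ⟨⟨b.1.1, Projectivization.mk ℂ b.zVec b.zVec_ne_zero⟩, by
    intro e h heq
    obtain ⟨c, hc⟩ := (Projectivization.mk_eq_mk_iff' ℂ _ _ _ _).1 heq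
    exact b.zVec_ne c e hc.symm⟩

/-- The identification `f_E : B(E)/CO(2) → P(E^ℂ) ∖ P(E)`, `[(x, y)] ↦ [x + i y]`. -/
noncomputable def ConfFrame.line : ConfFrame E → NonrealLine E :=
  Quotient.lift FrameBundle.line (by
    rintro b _ ⟨g, hg, rfl⟩
    apply Subtype.ext
    refine congrArg (Sigma.mk b.1.1) ?_
    refine ((Projectivization.mk_eq_mk_iff' ℂ _ _ _ _).2 ⟨(⟨g 0 0, -g 1 0⟩ : ℂ), ?_⟩).symm
    exact (b.zVec_act hg).symm)

end Complexification

section AlmostComplex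

/-- An almost-complex structure `J` on a smooth manifold `N` is integrable: around each point there
are complex coordinates, that is, a local diffeomorphism to some `ℂ^d` whose differential carries
`J` to multiplication by `i`. In particular `J` is smooth and `J² = -1`. -/
def IsIntegrable {V N : Type*} [NormedAddCommGroup V] [NormedSpace ℝ V] [TopologicalSpace N]
    [ChartedSpace V N] (J : ∀ x : N, TangentSpace 𝓘(ℝ, V) x →L[ℝ] TangentSpace 𝓘(ℝ, V) x) : Prop :=
  ∀ x : N, ∃ (d : ℕ) (e : OpenPartialHomeomorph N (Fin d → ℂ)), x ∈ e.source ∧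
    ContMDiffOn 𝓘(ℝ, V) 𝓘(ℝ, Fin d → ℂ) ∞ e e.source ∧
    ContMDiffOn 𝓘(ℝ, Fin d → ℂ) 𝓘(ℝ, V) ∞ e.symm e.target ∧
    ∀ y ∈ e.source, ∀ (v : TangentSpace 𝓘(ℝ, V) y) (i : Fin d),
      mfderiv 𝓘(ℝ, V) 𝓘(ℝ, Fin d → ℂ) e y (J y v) i =
        Complex.I * mfderiv 𝓘(ℝ, V) 𝓘(ℝ, Fin d → ℂ) e y v i

end AlmostComplex

section Structures
variable {M : Type*} [TopologicalSpace M]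

/-- A `GL(2)`-structure on a manifold `M` of dimension `k + 1`: an isomorphism of smooth vector
bundles `TM ≃ S^k(E)`. Smoothness: the inverse images of the symmetric products of smooth local
sections of `E` are smooth local vector fields. -/
structure GL2Structure (k : ℕ) [ChartedSpace (EuclideanSpace ℝ (Fin (k + 1))) M]
    [IsManifold (𝓡 (k + 1)) ∞ M]
    (E : M → Type*) [∀ p, AddCommGroup (E p)] [∀ p, Module ℝ (E p)] [∀ p, TopologicalSpace (E p)]
    [TopologicalSpace (TotalSpace Plane E)] [FiberBundle Plane E] [VectorBundle ℝ Plane E] where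
  iso : ∀ p : M, TangentSpace (𝓡 (k + 1)) p ≃ₗ[ℝ] Sym[ℝ]^k (E p)
  smooth : ∀ U : Set M, IsOpen U → ∀ s : Fin k → ∀ p : M, E p,
    (∀ i, ContMDiffOn (𝓡 (k + 1)) ((𝓡 (k + 1)).prod 𝓘(ℝ, Plane)) ∞
      (fun p => (⟨p, s i p⟩ : TotalSpace Plane E)) U) →
    ContMDiffOn (𝓡 (k + 1)) (𝓡 (k + 1)).tangent ∞
      (fun p => (⟨p, (iso p).symm (SymmetricPower.tprod ℝ fun i => s i p)⟩ :
        TangentBundle (𝓡 (k + 1)) M)) U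

/-- A `GL(2)`-connection: a smooth `gl(2)`-valued form `φ` on `B(E)` which is equivariant,
`R_g^* φ = g⁻¹ φ g`, and takes the value `A` on the velocity of `t ↦ b · γ(t)` whenever `γ(0) = 1`
and `γ'(0) = A`. In terms of matrix entries,
`φ^1_1 = φ 0 0`, `φ^2_1 = φ 0 1`, `φ^1_2 = φ 1 0`, `φ^2_2 = φ 1 1`. -/
structure GL2Connection (n : ℕ) [ChartedSpace (EuclideanSpace ℝ (Fin n)) M]
    [IsManifold (𝓡 n) ∞ M]
    (E : M → Type*) [∀ p, AddCommGroup (E p)] [∀ p, Module ℝ (E p)] [∀ p, TopologicalSpace (E p)]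
    [TopologicalSpace (TotalSpace Plane E)] [FiberBundle Plane E] [VectorBundle ℝ Plane E]
    [ContMDiffVectorBundle ∞ Plane E (𝓡 n)] where
  form : ∀ b : FrameBundle E,
    TangentSpace ((𝓡 n).prod 𝓘(ℝ, Plane × Plane)) b →L[ℝ] Matrix (Fin 2) (Fin 2) ℝ
  smooth : ∀ i j : Fin 2, ContMDiff ((𝓡 n).prod 𝓘(ℝ, Plane × Plane)).tangent 𝓘(ℝ, ℝ) ∞
    fun v : TangentBundle ((𝓡 n).prod 𝓘(ℝ, Plane × Plane)) (FrameBundle E) => form v.1 v.2 i j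
  equivariant : ∀ (g : GL (Fin 2) ℝ) (b : FrameBundle E)
    (v : TangentSpace ((𝓡 n).prod 𝓘(ℝ, Plane × Plane)) b),
    form (b.act g) (mfderiv ((𝓡 n).prod 𝓘(ℝ, Plane × Plane)) ((𝓡 n).prod 𝓘(ℝ, Plane × Plane))
      (fun c : FrameBundle E => c.act g) b v) =
      (g⁻¹ : GL (Fin 2) ℝ).val * form b v * g.val
  vertical : ∀ (b : FrameBundle E) (A : Matrix (Fin 2) (Fin 2) ℝ) (γ : ℝ → GL (Fin 2) ℝ),
    γ 0 = 1 → (∀ i j, HasDerivAt (fun t => γ t i j) (A i j) 0) →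
    form (b.act (γ 0)) (mfderiv 𝓘(ℝ, ℝ) ((𝓡 n).prod 𝓘(ℝ, Plane × Plane))
      (fun t : ℝ => b.act (γ t)) 0 (1 : ℝ)) = A

variable {k m : ℕ}
  {E : M → Type*} [∀ p, AddCommGroup (E p)] [∀ p, Module ℝ (E p)] [∀ p, TopologicalSpace (E p)]
  [TopologicalSpace (TotalSpace Plane E)] [FiberBundle Plane E] [VectorBundle ℝ Plane E]

section AnyDegree
variable [ChartedSpace (EuclideanSpace ℝ (Fin (k + 1))) M] [IsManifold (𝓡 (k + 1)) ∞ M]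

/-- The frame `(x^k, x^(k-1) y, …, y^k)` of `T_pM` given by the basis `b = (x, y)` of `E_p`. -/
noncomputable def GL2Structure.frame (Θ : GL2Structure k E) (b : FrameBundle E) :
    Module.Basis (Fin (k + 1)) ℝ (TangentSpace (𝓡 (k + 1)) b.1.1) :=
  basisOfTopLeSpanOfCardEqFinrank
    (fun i => (Θ.iso b.1.1).symm (symMonomial k b.1.2.1 b.1.2.2 i))
    (by
      have hr : Module.finrank ℝ (E b.1.1) = 2 := by
        rw [((trivializationAt Plane E b.1.1).linearEquivAt ℝ b.1.1
          (mem_baseSet_trivializationAt Plane E b.1.1)).finrank_eq]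
        simp
      have hb : LinearIndependent ℝ ![b.1.2.1, b.1.2.2] := b.2
      let β : Module.Basis (Fin 2) ℝ (E b.1.1) :=
        basisOfLinearIndependentOfCardEqFinrank hb (by simp [hr])
      have h0 : β 0 = b.1.2.1 := by simp [β]
      have h1 : β 1 = b.1.2.2 := by simp [β]
      have h := span_symMonomial k β
      rw [h0, h1] at h
      have h2 := congrArg
        (Submodule.map ((Θ.iso b.1.1).symm : Sym[ℝ]^k (E b.1.1) →ₗ[ℝ]
          TangentSpace (𝓡 (k + 1)) b.1.1)) h
      rw [Submodule.map_span, ← Set.range_comp, Submodule.map_top, LinearEquiv.range] at h2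
      exact h2.ge)
    (by
      change _ = Module.finrank ℝ (EuclideanSpace ℝ (Fin (k + 1)))
      simp)

/-- The soldering form: `ω_b(v)` is the coordinate vector of `dπ(v)` in the frame given by `b`. -/
noncomputable def GL2Structure.soldering (Θ : GL2Structure k E) (b : FrameBundle E)
    (v : TangentSpace ((𝓡 (k + 1)).prod 𝓘(ℝ, Plane × Plane)) b) : Fin (k + 1) → ℝ :=
  (Θ.frame b).equivFun
    (mfderiv ((𝓡 (k + 1)).prod 𝓘(ℝ, Plane × Plane)) (𝓡 (k + 1))
      (fun c : FrameBundle E => c.1.1) b v)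

/-- The element `z^(k-j) z̄^j` of `T_pM ⊗ ℂ ≃ S^k(E_p^ℂ)`, where `z = x + i y`, `z̄ = x - i y` and
`b = (x, y)`. -/
noncomputable def GL2Structure.zMonomial (Θ : GL2Structure k E) (b : FrameBundle E) (j : ℕ) :
    ℂ ⊗[ℝ] TangentSpace (𝓡 (k + 1)) b.1.1 :=
  ∑ i : Fin (k + 1), (zP ^ (k - j) * zbarP ^ j).coeff i ⊗ₜ[ℝ] Θ.frame b i

end AnyDegree

section OddDegree
variable [ChartedSpace (EuclideanSpace ℝ (Fin (2 * m + 1 + 1))) M]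
  [IsManifold (𝓡 (2 * m + 1 + 1)) ∞ M]

/-- `J` is the complex structure `J_z` on `T_pM`, `z = x + i y`, `b = (x, y)`: the vectors of type
`(0, 1)` form the span of `z^k, z^(k-1) z̄, …, z^(m+1) z̄^m`, where `k = 2m + 1`. -/
def GL2Structure.IsComplexStructureAt (Θ : GL2Structure (2 * m + 1) E) (b : FrameBundle E)
    (J : TangentSpace (𝓡 (2 * m + 1 + 1)) b.1.1 →L[ℝ] TangentSpace (𝓡 (2 * m + 1 + 1)) b.1.1) :
    Prop :=
  (∀ v, J (J v) = -v) ∧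
    Module.End.eigenspace
        (LinearMap.baseChange ℂ
          (J : TangentSpace (𝓡 (2 * m + 1 + 1)) b.1.1 →ₗ[ℝ] TangentSpace (𝓡 (2 * m + 1 + 1)) b.1.1))
        (-Complex.I) =
      Submodule.span ℂ (Set.range fun j : Fin (m + 1) => Θ.zMonomial b j)

variable [ContMDiffVectorBundle ∞ Plane E (𝓡 (2 * m + 1 + 1))]

/-- The form `ζ = (φ^1_2 + φ^2_1) + i (φ^2_2 - φ^1_1)` on `B(E)`. -/
noncomputable def GL2Connection.zeta {n : ℕ} [ChartedSpace (EuclideanSpace ℝ (Fin n)) M]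
    [IsManifold (𝓡 n) ∞ M] [ContMDiffVectorBundle ∞ Plane E (𝓡 n)]
    (φ : GL2Connection n E) (b : FrameBundle E)
    (v : TangentSpace ((𝓡 n).prod 𝓘(ℝ, Plane × Plane)) b) : ℂ :=
  ⟨φ.form b v 1 0 + φ.form b v 0 1, φ.form b v 1 1 - φ.form b v 0 0⟩

/-- The almost-complex structure `J_φ` on `B(E)/CO(2)`: its `(1, 0)`-forms pull back to `B(E)` to the
linear combinations of `ξ^{k,0}, …, ξ^{k,m}` and `ζ`. That is, if `ξ^{k,j}(v') = i ξ^{k,j}(v)` for all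
`j` and `ζ(v') = i ζ(v)` at a point `b` of `B(E)`, then `J_φ` sends the image of `v` to the image of
`v'`. At each point of `B(E)/CO(2)` this determines `J_φ`, and by the equivariance of the forms it
does not depend on the representative `b`. -/
noncomputable def almostComplexStructure (Θ : GL2Structure (2 * m + 1) E)
    (φ : GL2Connection (2 * m + 1 + 1) E) (χ : ConfFrame E) :
    TangentSpace 𝓘(ℝ, EuclideanSpace ℝ (Fin (2 * m + 1 + 1)) × ℂ) χ →L[ℝ]
      TangentSpace 𝓘(ℝ, EuclideanSpace ℝ (Fin (2 * m + 1 + 1)) × ℂ) χ :=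
  Classical.epsilon fun J => ∃ b : FrameBundle E, ConfFrame.mk b = χ ∧
    ∀ v v' : TangentSpace ((𝓡 (2 * m + 1 + 1)).prod 𝓘(ℝ, Plane × Plane)) b,
      (∀ j, xiForm m j (Θ.soldering b v') = Complex.I * xiForm m j (Θ.soldering b v)) →
      φ.zeta b v' = Complex.I * φ.zeta b v →
      J (mfderiv ((𝓡 (2 * m + 1 + 1)).prod 𝓘(ℝ, Plane × Plane))
          𝓘(ℝ, EuclideanSpace ℝ (Fin (2 * m + 1 + 1)) × ℂ) ConfFrame.mk b v) =
        mfderiv ((𝓡 (2 * m + 1 + 1)).prod 𝓘(ℝ, Plane × Plane))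
          𝓘(ℝ, EuclideanSpace ℝ (Fin (2 * m + 1 + 1)) × ℂ) ConfFrame.mk b v'

/-- `σ` is a holomorphic section of `B(E)/CO(2) → M`: a smooth section whose image is a complex
submanifold, i.e. has `J_φ`-invariant tangent spaces. -/
structure IsHolomorphicSection (Θ : GL2Structure (2 * m + 1) E)
    (φ : GL2Connection (2 * m + 1 + 1) E) (σ : M → ConfFrame E) : Prop where
  smooth : ContMDiff (𝓡 (2 * m + 1 + 1))
    𝓘(ℝ, EuclideanSpace ℝ (Fin (2 * m + 1 + 1)) × ℂ) ∞ σ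
  proj_eq : ∀ p, (σ p).proj = p
  invariant : ∀ (p : M) (v : TangentSpace (𝓡 (2 * m + 1 + 1)) p),
    ∃ w : TangentSpace (𝓡 (2 * m + 1 + 1)) p,
      almostComplexStructure Θ φ (σ p)
        (mfderiv (𝓡 (2 * m + 1 + 1)) 𝓘(ℝ, EuclideanSpace ℝ (Fin (2 * m + 1 + 1)) × ℂ) σ p v) =
      mfderiv (𝓡 (2 * m + 1 + 1)) 𝓘(ℝ, EuclideanSpace ℝ (Fin (2 * m + 1 + 1)) × ℂ) σ p w

end OddDegree

end Structures

end GL2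

/-! The tangent spaces of the image of `σ` are `J_φ`-invariant and `dσ` is injective, since `proj ∘
σ = id`. Hence `J_φ` pulls back to an almost-complex structure `J` on `M` with `dσ ∘ J = J_φ ∘ dσ`.
Two things remain: `J` is integrable, and `J` at `p` is `J_z` for the line `[z]` of `σ(p)`.

Integrability is the fact that a complex submanifold of a complex manifold is a complex manifold
(`IsIntegrable.of_immersion`). If `e` is a holomorphic chart of the ambient manifold near `σ(x)`,
then `d(e ∘ σ)` intertwines `J` with `i`, so its image at `x` is a complex subspace of `ℂ^d`. A
complex linear projection onto that subspace, composed with `e ∘ σ`, has invertible derivative at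
`x`, and the inverse function theorem makes it a complex chart.

For the identification, the forms `ξ_j` are semibasic: at a frame `b` they come from a real
isomorphism `T_pM ≃ ℂ^(m+1)`. Since the `(1,0)`-forms of `J_φ` are spanned by the `ξ_j` and `ζ`, the
projection to `M` turns `J_φ` at `[b]` into multiplication by `i` in this isomorphism, whatever the
value of `ζ` (`IsHolomorphicSection.exists_complexStructure`). By duality it sends `V_j^even` to
`V_j^odd`, so the `(0,1)`-vectors are spanned by `V_j^even + i V_j^odd = z^(k-j) z̄^j`, `j ≤ m`
(`GL2Structure.isComplexStructureAt_of_coframe`). An element of `CO(2)` rescales `z` and `z̄` by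
conjugate complex numbers, hence preserves this span (`GL2Structure.isComplexStructureAt_act`), and
two frames with the same line differ by such an element.

As `J_φ` is defined by a choice operator, its defining property must first be shown to be
satisfiable (`almostComplexStructure_spec`). This needs the kernel of `(ξ_0, …, ξ_m, ζ)` to be
tangent to the `CO(2)`-orbits. -/

namespace GL2

/-! ### Derivatives of the projections of `B(E)` and `B(E)/CO(2)` in the preferred charts. -/

section ChartDerivatives

/-- A map between manifolds without boundary which is `g` in the preferred charts at `x` and `f x`
has the derivative of `g`. -/
theorem hasMFDerivAt_of_extChartAt_eventuallyEq {V H N V' H' N' : Type*}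
    [NormedAddCommGroup V] [NormedSpace ℝ V] [TopologicalSpace H] {I : ModelWithCorners ℝ V H}
    [I.Boundaryless] [TopologicalSpace N] [ChartedSpace H N]
    [NormedAddCommGroup V'] [NormedSpace ℝ V'] [TopologicalSpace H']
    {I' : ModelWithCorners ℝ V' H'} [TopologicalSpace N'] [ChartedSpace H' N']
    {f : N → N'} {x : N} (hf : ContinuousAt f x) {g : V → V'} {g' : V →L[ℝ] V'}
    (hg : HasFDerivAt g g' (extChartAt I x x))
    (h : ∀ᶠ c in nhds x, extChartAt I' (f x) (f c) = g (extChartAt I x c)) :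
    HasMFDerivAt I I' f x g' := by
  refine ⟨hf, ?_⟩
  suffices hw : HasFDerivAt (writtenInExtChartAt I I' x f) g' (extChartAt I x x) from
    hw.hasFDerivWithinAt
  refine hg.congr_of_eventuallyEq ?_
  have h1 : Filter.Tendsto (extChartAt I x).symm (nhds (extChartAt I x x)) (nhds x) := by
    simpa [ContinuousAt] using continuousAt_extChartAt_symm (I := I) x
  filter_upwards [h1.eventually h, extChartAt_target_mem_nhds (I := I) x] with u hu hut
  simp only [writtenInExtChartAt, Function.comp_apply]
  rw [hu, (extChartAt I x).right_inv hut]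

variable {n : ℕ} {M : Type*} [TopologicalSpace M] [ChartedSpace (EuclideanSpace ℝ (Fin n)) M]
  {E : M → Type*} [∀ p, AddCommGroup (E p)] [∀ p, Module ℝ (E p)] [∀ p, TopologicalSpace (E p)]
  [TopologicalSpace (TotalSpace Plane E)] [FiberBundle Plane E] [VectorBundle ℝ Plane E]

theorem FrameBundle.extChartAt_apply (b c : FrameBundle E) :
    extChartAt ((𝓡 n).prod 𝓘(ℝ, Plane × Plane)) b c =
      (chartAt (EuclideanSpace ℝ (Fin n)) b.1.1 c.1.1,
        (trivializationAt Plane E b.1.1 ⟨c.1.1, c.1.2.1⟩).2,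
        (trivializationAt Plane E b.1.1 ⟨c.1.1, c.1.2.2⟩).2) := by
  rfl

theorem ConfFrame.extChartAt_apply (χ ψ : ConfFrame E) :
    extChartAt 𝓘(ℝ, EuclideanSpace ℝ (Fin n) × ℂ) χ ψ =
      (chartAt (EuclideanSpace ℝ (Fin n)) χ.proj ψ.proj, ψ.wCoord χ.proj) := by
  rfl

variable (n) in
-- The preferred chart at `b` lies over the preferred chart at its base point, so the derivative is
-- literally the first projection of the model space. Vertical vectors are thus the pairs with first
-- component zero.
theorem FrameBundle.hasMFDerivAt_base (b : FrameBundle E) :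
    HasMFDerivAt ((𝓡 n).prod 𝓘(ℝ, Plane × Plane)) (𝓡 n) (fun c : FrameBundle E => c.1.1) b
      (ContinuousLinearMap.fst ℝ (EuclideanSpace ℝ (Fin n)) (Plane × Plane)) := by
  refine hasMFDerivAt_of_extChartAt_eventuallyEq FrameBundle.continuous_base.continuousAt
    (g := Prod.fst) hasFDerivAt_fst (Filter.Eventually.of_forall fun c => ?_)
  rw [FrameBundle.extChartAt_apply]
  rfl

variable (n) in
theorem ConfFrame.hasMFDerivAt_proj (χ : ConfFrame E) :
    HasMFDerivAt 𝓘(ℝ, EuclideanSpace ℝ (Fin n) × ℂ) (𝓡 n) (ConfFrame.proj (E := E)) χ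
      (ContinuousLinearMap.fst ℝ (EuclideanSpace ℝ (Fin n)) ℂ) := by
  refine hasMFDerivAt_of_extChartAt_eventuallyEq ConfFrame.continuous_proj.continuousAt
    (g := Prod.fst) hasFDerivAt_fst (Filter.Eventually.of_forall fun c => ?_)
  rw [ConfFrame.extChartAt_apply]
  rfl

/-- The complex vector `x + i y` of coordinates of a pair of real vectors. -/
noncomputable def pairCoord (i : Fin 2) : Plane × Plane →L[ℝ] ℂ :=
  Complex.ofRealCLM ∘L ContinuousLinearMap.proj i ∘L ContinuousLinearMap.fst ℝ Plane Plane +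
    (Complex.I • Complex.ofRealCLM) ∘L ContinuousLinearMap.proj i ∘L
      ContinuousLinearMap.snd ℝ Plane Plane

theorem pairCoord_apply (i : Fin 2) (v : Plane × Plane) :
    pairCoord i v = ⟨v.1 i, v.2 i⟩ := by
  apply Complex.ext <;> simp [pairCoord]

variable (n) in
-- In the preferred charts the quotient map is the identity on the base times the fibre map `(x, y)
-- ↦ z₁ / z₀`. Only the block form and the surjectivity of the fibre part are used later.
theorem ConfFrame.exists_hasMFDerivAt_mk (b : FrameBundle E) :
    ∃ w' : Plane × Plane →L[ℝ] ℂ, Function.Surjective w' ∧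
      HasMFDerivAt ((𝓡 n).prod 𝓘(ℝ, Plane × Plane)) 𝓘(ℝ, EuclideanSpace ℝ (Fin n) × ℂ)
        (ConfFrame.mk (E := E)) b
        ((ContinuousLinearMap.id ℝ (EuclideanSpace ℝ (Fin n))).prodMap w') := by
  set e := trivializationAt Plane E b.1.1 with he
  have hbe : b.1.1 ∈ e.baseSet := mem_baseSet_trivializationAt Plane E b.1.1
  set v₀ : Plane × Plane := ((e ⟨b.1.1, b.1.2.1⟩).2, (e ⟨b.1.1, b.1.2.2⟩).2) with hv₀
  have hz : ∀ c : FrameBundle E, c.1.1 ∈ e.baseSet → ∀ i, c.zCoord b.1.1 i =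
      pairCoord i ((e ⟨c.1.1, c.1.2.1⟩).2, (e ⟨c.1.1, c.1.2.2⟩).2) := by
    intro c hc i
    rw [pairCoord_apply]
    simp only [FrameBundle.zCoord, ← he, e.linearMapAt_apply, if_pos hc]
  have h0 : pairCoord 0 v₀ ≠ 0 := by
    rw [← hz b hbe]; exact b.zCoord_ne_zero _ hbe
  have hw : HasFDerivAt (fun v : Plane × Plane => pairCoord 1 v / pairCoord 0 v)
      ((pairCoord 0 v₀)⁻¹ • pairCoord 1 -
        (pairCoord 1 v₀ / pairCoord 0 v₀ ^ 2) • pairCoord 0 : Plane × Plane →L[ℝ] ℂ) v₀ := by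
    have h1 := (pairCoord 1).hasFDerivAt (x := v₀)
    have h2 := (pairCoord 0).hasFDerivAt (x := v₀)
    have h3 := h1.mul (((hasDerivAt_inv h0).hasFDerivAt.restrictScalars ℝ).comp v₀ h2)
    refine h3.congr_fderiv ?_
    refine ContinuousLinearMap.ext fun v => ?_
    simp
    field_simp
    ring
  refine ⟨_, ?_, hasMFDerivAt_of_extChartAt_eventuallyEq ConfFrame.continuous_mk.continuousAt
    (g := Prod.map id fun v => pairCoord 1 v / pairCoord 0 v)
      (HasFDerivAt.prodMap (p := (_, v₀)) (hasFDerivAt_id _) hw) ?_⟩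
  · intro a
    -- Keep `z₀` fixed and move `z₁` with velocity `a z₀`: then `z₁ / z₀` has velocity `a`.
    refine ⟨(![0, (a * pairCoord 0 v₀).re], ![0, (a * pairCoord 0 v₀).im]), ?_⟩
    have h1 : pairCoord 1 (![0, (a * pairCoord 0 v₀).re], ![0, (a * pairCoord 0 v₀).im]) =
        a * pairCoord 0 v₀ := by rw [pairCoord_apply]; rfl
    have h2 : pairCoord 0 (![0, (a * pairCoord 0 v₀).re], ![0, (a * pairCoord 0 v₀).im]) = 0 := by
      rw [pairCoord_apply]; simp; rfl
    simp only [sub_apply, smul_apply, h1, h2, smul_eq_mul]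
    field_simp
    simp
  · filter_upwards [(e.open_baseSet.preimage FrameBundle.continuous_base).mem_nhds hbe] with c hc
    rw [FrameBundle.extChartAt_apply, ConfFrame.extChartAt_apply]
    refine Prod.ext rfl ?_
    simp only [ConfFrame.wCoord_mk, ConfFrame.proj_mk]
    rw [hz c hc, hz c hc]
    rfl

theorem mfderiv_proj_mfderiv_mk (b : FrameBundle E)
    (v : TangentSpace ((𝓡 n).prod 𝓘(ℝ, Plane × Plane)) b) :
    mfderiv 𝓘(ℝ, EuclideanSpace ℝ (Fin n) × ℂ) (𝓡 n)
      (ConfFrame.proj (E := E)) (ConfFrame.mk b)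
      (mfderiv ((𝓡 n).prod 𝓘(ℝ, Plane × Plane))
        𝓘(ℝ, EuclideanSpace ℝ (Fin n) × ℂ) ConfFrame.mk b v) =
    mfderiv ((𝓡 n).prod 𝓘(ℝ, Plane × Plane)) (𝓡 n)
      (fun c : FrameBundle E => c.1.1) b v := by
  obtain ⟨_, -, h⟩ := ConfFrame.exists_hasMFDerivAt_mk n b
  exact (DFunLike.congr_fun (mfderiv_comp b
    (ConfFrame.hasMFDerivAt_proj n (ConfFrame.mk b)).mdifferentiableAt
    h.mdifferentiableAt) v).symm

theorem mfderiv_mk_surjective (b : FrameBundle E) :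
    Function.Surjective (mfderiv ((𝓡 n).prod 𝓘(ℝ, Plane × Plane))
      𝓘(ℝ, EuclideanSpace ℝ (Fin n) × ℂ) (ConfFrame.mk (E := E)) b) := by
  obtain ⟨w', hw, h⟩ := ConfFrame.exists_hasMFDerivAt_mk n b
  rw [h.mfderiv]
  exact Function.surjective_id.prodMap hw

end ChartDerivatives

/-! ### Vertical vectors and the kernel of `ζ`. -/

section Connection

variable {n : ℕ} {M : Type*} [TopologicalSpace M] [ChartedSpace (EuclideanSpace ℝ (Fin n)) M]
  [IsManifold (𝓡 n) ∞ M]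
  {E : M → Type*} [∀ p, AddCommGroup (E p)] [∀ p, Module ℝ (E p)] [∀ p, TopologicalSpace (E p)]
  [TopologicalSpace (TotalSpace Plane E)] [FiberBundle Plane E] [VectorBundle ℝ Plane E]

open Classical in
/-- The curve `t ↦ 1 + t A` in `GL(2)`, cut off where it is not invertible. -/
noncomputable def lineGL (A : Matrix (Fin 2) (Fin 2) ℝ) (t : ℝ) : GL (Fin 2) ℝ :=
  if h : (1 + t • A).det ≠ 0 then Matrix.GeneralLinearGroup.mkOfDetNeZero _ h else 1

theorem lineGL_zero (A : Matrix (Fin 2) (Fin 2) ℝ) : lineGL A 0 = 1 := by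
  rw [lineGL, dif_pos (by simp)]
  apply Units.ext
  simp [Matrix.GeneralLinearGroup.mkOfDetNeZero]

theorem hasDerivAt_lineGL (A : Matrix (Fin 2) (Fin 2) ℝ) (i j : Fin 2) :
    HasDerivAt (fun t => lineGL A t i j) (A i j) 0 := by
  have h1 : HasDerivAt (fun t : ℝ => (1 : Matrix (Fin 2) (Fin 2) ℝ) i j + t * A i j) (A i j) 0 := by
    simpa using ((hasDerivAt_id (0 : ℝ)).mul_const (A i j)).const_add
      ((1 : Matrix (Fin 2) (Fin 2) ℝ) i j)
  refine h1.congr_of_eventuallyEq ?_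
  have h2 : Continuous fun t : ℝ => (1 + t • A).det := by fun_prop
  have h3 : (1 + (0 : ℝ) • A).det ≠ 0 := by simp
  filter_upwards [h2.continuousAt.eventually_ne h3] with t ht
  rw [lineGL, dif_pos ht]
  simp [Matrix.GeneralLinearGroup.mkOfDetNeZero]

/-- `CO(2)` consists of the invertible elements of a linear space of matrices which contains `1`, so
a line through `1` in this space stays in `CO(2)`, and no exponential is needed. The cut-off value
`1` lies in `CO(2)` too. -/
theorem lineGL_mem_CO2 {A : Matrix (Fin 2) (Fin 2) ℝ} (h1 : A 0 0 = A 1 1) (h2 : A 0 1 = -A 1 0)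
    (t : ℝ) : lineGL A t ∈ CO2 := by
  rw [lineGL]
  split_ifs with h
  · constructor <;> simp [Matrix.GeneralLinearGroup.mkOfDetNeZero, h1, h2]
  · exact CO2.one_mem

variable [ContMDiffVectorBundle ∞ Plane E (𝓡 n)] (φ : GL2Connection n E)

/-- The vector is the velocity at `0` of `t ↦ b · (1 + tA)`. This curve has constant image in `M`,
and constant image in `B(E)/CO(2)` when `A` is in the Lie algebra of `CO(2)`. -/
theorem GL2Connection.exists_vertical (b : FrameBundle E) (A : Matrix (Fin 2) (Fin 2) ℝ) :
    ∃ v : TangentSpace ((𝓡 n).prod 𝓘(ℝ, Plane × Plane)) b,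
      mfderiv ((𝓡 n).prod 𝓘(ℝ, Plane × Plane)) (𝓡 n) (fun c : FrameBundle E => c.1.1) b v = 0 ∧
      φ.form b v = A ∧
      (A 0 0 = A 1 1 → A 0 1 = -A 1 0 → mfderiv ((𝓡 n).prod 𝓘(ℝ, Plane × Plane))
        𝓘(ℝ, EuclideanSpace ℝ (Fin n) × ℂ) ConfFrame.mk b v = 0) := by
  -- For `A ≠ 0` the differentiability of the curve comes for free: otherwise its `mfderiv` would be
  -- the default value `0`, on which `φ` cannot take the value `A`.
  by_cases hA : A = 0
  · exact ⟨0, map_zero _, by rw [map_zero, hA], fun _ _ => map_zero _⟩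
  -- The velocity lives at `b.act (lineGL A 0)`, which equals `b` only propositionally. A predicate
  -- on frames carries the claim across this equality.
  let P : FrameBundle E → Prop := fun b => ∃ v : TangentSpace ((𝓡 n).prod 𝓘(ℝ, Plane × Plane)) b,
      mfderiv ((𝓡 n).prod 𝓘(ℝ, Plane × Plane)) (𝓡 n) (fun c : FrameBundle E => c.1.1) b v = 0 ∧
      φ.form b v = A ∧
      (A 0 0 = A 1 1 → A 0 1 = -A 1 0 → mfderiv ((𝓡 n).prod 𝓘(ℝ, Plane × Plane))
        𝓘(ℝ, EuclideanSpace ℝ (Fin n) × ℂ) ConfFrame.mk b v = 0)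
  have key : P (b.act (lineGL A 0)) := by
    have hv := φ.vertical b A (lineGL A) (lineGL_zero A) (hasDerivAt_lineGL A)
    have hd : MDifferentiableAt 𝓘(ℝ, ℝ) ((𝓡 n).prod 𝓘(ℝ, Plane × Plane))
        (fun t : ℝ => b.act (lineGL A t)) 0 := by
      by_contra h
      rw [mfderiv_zero_of_not_mdifferentiableAt h] at hv
      exact hA (hv.symm.trans (map_zero (φ.form (b.act (lineGL A 0)))))
    refine ⟨_, ?_, hv, fun h1 h2 => ?_⟩
    · have h3 := (FrameBundle.hasMFDerivAt_base n (b.act (lineGL A 0))).mdifferentiableAt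
      have h4 := mfderiv_comp (0 : ℝ) h3 hd
      have h5 : (fun c : FrameBundle E => c.1.1) ∘ (fun t : ℝ => b.act (lineGL A t)) =
          fun _ => b.1.1 := rfl
      rw [h5, mfderiv_const] at h4
      exact (DFunLike.congr_fun h4 (1 : ℝ)).symm
    · obtain ⟨_, _, h⟩ := ConfFrame.exists_hasMFDerivAt_mk n (b.act (lineGL A 0))
      have h4 := mfderiv_comp (0 : ℝ) h.mdifferentiableAt hd
      have h5 : ConfFrame.mk ∘ (fun t : ℝ => b.act (lineGL A t)) = fun _ => ConfFrame.mk b :=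
        funext fun t => (ConfFrame.mk_eq_mk.2 ⟨_, lineGL_mem_CO2 h1 h2 t, rfl⟩).symm
      rw [h5, mfderiv_const] at h4
      exact (DFunLike.congr_fun h4 (1 : ℝ)).symm
  rw [lineGL_zero, b.act_one] at key
  exact key

/-- On the vertical space, of dimension 4, the connection form is onto `gl(2)`, also of dimension 4,
so it is injective there. -/
theorem GL2Connection.eq_of_form_eq (b : FrameBundle E)
    {v w : TangentSpace ((𝓡 n).prod 𝓘(ℝ, Plane × Plane)) b}
    (hv : mfderiv ((𝓡 n).prod 𝓘(ℝ, Plane × Plane)) (𝓡 n) (fun c : FrameBundle E => c.1.1) b v = 0)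
    (hw : mfderiv ((𝓡 n).prod 𝓘(ℝ, Plane × Plane)) (𝓡 n) (fun c : FrameBundle E => c.1.1) b w = 0)
    (h : φ.form b v = φ.form b w) : v = w := by
  have hs := fun A => φ.exists_vertical b A
  rw [(FrameBundle.hasMFDerivAt_base n b).mfderiv] at hv hw
  simp only [(FrameBundle.hasMFDerivAt_base n b).mfderiv] at hs
  let F : EuclideanSpace ℝ (Fin n) × (Plane × Plane) →L[ℝ] Matrix (Fin 2) (Fin 2) ℝ := φ.form b
  let ψ : Plane × Plane →ₗ[ℝ] Matrix (Fin 2) (Fin 2) ℝ :=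
    F.toLinearMap ∘ₗ LinearMap.inr ℝ _ _
  have hψ : ∀ u : EuclideanSpace ℝ (Fin n) × (Plane × Plane), u.1 = 0 → ψ u.2 = F u := by
    rintro ⟨u, u'⟩ rfl; rfl
  have hsurj : Function.Surjective ψ := fun A => by
    obtain ⟨v, h1, h2, -⟩ := hs A
    exact ⟨v.2, (hψ v h1).trans h2⟩
  have hinj : Function.Injective ψ :=
    (LinearMap.injective_iff_surjective_of_finrank_eq_finrank
      (by simp [Module.finrank_matrix])).2 hsurj
  exact Prod.ext (hv.trans hw.symm) (hinj ((hψ v hv).trans (h.trans (hψ w hw).symm)))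

/-- The equation `ζ(v) = 0` says that `φ(v)` lies in the Lie algebra of `CO(2)`. A vertical `v` is
determined by `φ(v)`, so it is the vector of `exists_vertical`, which the quotient map kills. -/
theorem GL2Connection.mfderiv_mk_eq_zero (b : FrameBundle E)
    {v : TangentSpace ((𝓡 n).prod 𝓘(ℝ, Plane × Plane)) b}
    (hv : mfderiv ((𝓡 n).prod 𝓘(ℝ, Plane × Plane)) (𝓡 n) (fun c : FrameBundle E => c.1.1) b v = 0)
    (h : φ.zeta b v = 0) :
    mfderiv ((𝓡 n).prod 𝓘(ℝ, Plane × Plane)) 𝓘(ℝ, EuclideanSpace ℝ (Fin n) × ℂ)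
      ConfFrame.mk b v = 0 := by
  obtain ⟨w, h1, h2, h3⟩ := φ.exists_vertical b (φ.form b v)
  obtain rfl := φ.eq_of_form_eq b h1 hv h2
  have hre := congrArg Complex.re h
  have him := congrArg Complex.im h
  simp only [GL2Connection.zeta, Complex.zero_re, Complex.zero_im] at hre him
  exact h3 (by linarith) (by linarith)

/-- The form `ζ` at a point, as a linear map. -/
noncomputable def GL2Connection.zetaLinear (b : FrameBundle E) :
    TangentSpace ((𝓡 n).prod 𝓘(ℝ, Plane × Plane)) b →ₗ[ℝ] ℂ where
  toFun := φ.zeta b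
  map_add' v w := by
    apply Complex.ext <;> simp [GL2Connection.zeta] <;> ring
  map_smul' c v := by
    apply Complex.ext <;> simp [GL2Connection.zeta] <;> ring

end Connection

/-! ### The forms `ξ_j`, `ζ` and the existence of `J_φ`. -/

section Coframe

/-- The forms `ξ^{k,j}` as a real isomorphism `𝕍_k ≃ ℂ^(m+1)`. -/
noncomputable def xiEquiv (m : ℕ) : (Fin (2 * m + 1 + 1) → ℝ) ≃ₗ[ℝ] (Fin (m + 1) → ℂ) :=
  LinearMap.linearEquivOfInjective
    { toFun := fun a j => xiForm m j a
      map_add' := fun a b => by ext j; apply Complex.ext <;> simp [xiForm]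
      map_smul' := fun c a => by ext j; apply Complex.ext <;> simp [xiForm] }
    (by
      rw [← LinearMap.ker_eq_bot, LinearMap.ker_eq_bot']
      intro a ha
      have h : ∀ j, xiForm m j a = 0 := fun j => congrFun ha j
      apply (evenOddBasis m).repr.injective
      ext i
      rcases i with j | j
      · simpa [xiForm] using congrArg Complex.re (h j)
      · simpa [xiForm] using congrArg Complex.im (h j))
    (by simp [Module.finrank_pi_fintype]; ring)

theorem xiEquiv_apply (m : ℕ) (a : Fin (2 * m + 1 + 1) → ℝ) (j : Fin (m + 1)) :
    xiEquiv m a j = xiForm m j a := rfl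

variable {m : ℕ} {M : Type*} [TopologicalSpace M]
  [ChartedSpace (EuclideanSpace ℝ (Fin (2 * m + 1 + 1))) M]
  [IsManifold (𝓡 (2 * m + 1 + 1)) ∞ M]
  {E : M → Type*} [∀ p, AddCommGroup (E p)] [∀ p, Module ℝ (E p)] [∀ p, TopologicalSpace (E p)]
  [TopologicalSpace (TotalSpace Plane E)] [FiberBundle Plane E] [VectorBundle ℝ Plane E]

/-- The complex coordinates of tangent vectors of `M` given by the forms `ξ^{k,j}` and a frame. -/
noncomputable def GL2Structure.coframe (Θ : GL2Structure (2 * m + 1) E) (b : FrameBundle E) :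
    TangentSpace (𝓡 (2 * m + 1 + 1)) b.1.1 ≃ₗ[ℝ] (Fin (m + 1) → ℂ) :=
  (Θ.frame b).equivFun.trans (xiEquiv m)

/-- The forms `ξ_j` on `B(E)` are semibasic: they see a vector only through its image in `M`. -/
theorem GL2Structure.coframe_mfderiv_apply (Θ : GL2Structure (2 * m + 1) E) (b : FrameBundle E)
    (v : TangentSpace ((𝓡 (2 * m + 1 + 1)).prod 𝓘(ℝ, Plane × Plane)) b) (j : Fin (m + 1)) :
    Θ.coframe b (mfderiv ((𝓡 (2 * m + 1 + 1)).prod 𝓘(ℝ, Plane × Plane)) (𝓡 (2 * m + 1 + 1))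
      (fun c : FrameBundle E => c.1.1) b v) j = xiForm m j (Θ.soldering b v) := rfl

/-- Since `g` vanishes on the kernel of `f`, it induces a surjection `W → U`, an isomorphism by
equality of dimensions; `J` is the conjugate of `T` by it. It is applied to `f = (ξ, ζ)`, `g` the
derivative of the quotient map and `T` multiplication by `i`. -/
theorem exists_linearMap_semiconj {K V W U : Type*} [Field K] [AddCommGroup V] [Module K V]
    [AddCommGroup W] [Module K W] [AddCommGroup U] [Module K U] [FiniteDimensional K W]
    [FiniteDimensional K U] (f : V →ₗ[K] W) (g : V →ₗ[K] U) (hf : Function.Surjective f)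
    (hg : Function.Surjective g) (hfg : LinearMap.ker f ≤ LinearMap.ker g)
    (hd : Module.finrank K W = Module.finrank K U) (T : W →ₗ[K] W) :
    ∃ J : U →ₗ[K] U, ∀ v v', f v' = T (f v) → J (g v) = g v' := by
  obtain ⟨S, hS⟩ := f.exists_rightInverse_of_surjective (LinearMap.range_eq_top.2 hf)
  have hS' : ∀ x, f (S x) = x := fun x => LinearMap.congr_fun hS x
  have hgf : ∀ v, (g ∘ₗ S) (f v) = g v := fun v => by
    have : S (f v) - v ∈ LinearMap.ker f := by simp [hS']
    have := hfg this
    simpa [sub_eq_zero] using this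
  have hsurj : Function.Surjective (g ∘ₗ S) := fun u => by
    obtain ⟨v, rfl⟩ := hg u
    exact ⟨f v, hgf v⟩
  let e := LinearEquiv.ofBijective (g ∘ₗ S)
    ⟨(LinearMap.injective_iff_surjective_of_finrank_eq_finrank hd).2 hsurj, hsurj⟩
  refine ⟨(g ∘ₗ S) ∘ₗ T ∘ₗ e.symm, fun v v' h => ?_⟩
  have h1 : e.symm (g v) = f v := by
    rw [LinearEquiv.symm_apply_eq]; exact (hgf v).symm
  change (g ∘ₗ S) (T (e.symm (g v))) = g v'
  rw [h1, ← h, hgf]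

variable [ContMDiffVectorBundle ∞ Plane E (𝓡 (2 * m + 1 + 1))]

/-- Tangent vectors of `B(E)` with prescribed image in `M` and prescribed value of `ζ`. -/
theorem GL2Connection.exists_mfderiv_base_eq_and_zeta_eq
    (φ : GL2Connection (2 * m + 1 + 1) E) (b : FrameBundle E)
    (u : TangentSpace (𝓡 (2 * m + 1 + 1)) b.1.1) (c : ℂ) :
    ∃ v : TangentSpace ((𝓡 (2 * m + 1 + 1)).prod 𝓘(ℝ, Plane × Plane)) b,
      mfderiv ((𝓡 (2 * m + 1 + 1)).prod 𝓘(ℝ, Plane × Plane)) (𝓡 (2 * m + 1 + 1))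
        (fun c : FrameBundle E => c.1.1) b v = u ∧ φ.zeta b v = c := by
  obtain ⟨h, hh⟩ : ∃ h : TangentSpace ((𝓡 (2 * m + 1 + 1)).prod 𝓘(ℝ, Plane × Plane)) b,
      mfderiv ((𝓡 (2 * m + 1 + 1)).prod 𝓘(ℝ, Plane × Plane)) (𝓡 (2 * m + 1 + 1))
        (fun c : FrameBundle E => c.1.1) b h = u := by
    rw [(FrameBundle.hasMFDerivAt_base _ b).mfderiv]
    exact ⟨((u, 0) : EuclideanSpace ℝ (Fin (2 * m + 1 + 1)) × (Plane × Plane)), rfl⟩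
  set d := c - φ.zeta b h
  -- With first column zero, `ζ` is the second column read as a complex number, so this vertical
  -- vector corrects `ζ` by exactly `d`.
  obtain ⟨v, hv1, hv2, -⟩ := φ.exists_vertical b !![0, d.re; 0, d.im]
  refine ⟨h + v, by rw [map_add, hh, hv1, add_zero], ?_⟩
  have hz : φ.zeta b v = d := by
    apply Complex.ext <;> simp [GL2Connection.zeta, hv2]
  have := (φ.zetaLinear b).map_add h v
  change φ.zeta b (h + v) = φ.zeta b h + φ.zeta b v at this
  rw [this, hz]
  simp [d]

/-- The map `(ξ, ζ)` is onto `ℂ^(m+1) × ℂ`, of the same real dimension `2m + 4` as `B(E)/CO(2)`, and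
its kernel is killed by the quotient map, so multiplication by `i` descends. The property is
asserted for one representative only; other frames over the same point are reached later through the
`CO(2)`-invariance of `J_z`. -/
theorem almostComplexStructure_spec (Θ : GL2Structure (2 * m + 1) E)
    (φ : GL2Connection (2 * m + 1 + 1) E) (χ : ConfFrame E) :
    ∃ b : FrameBundle E, ConfFrame.mk b = χ ∧
    ∀ v v' : TangentSpace ((𝓡 (2 * m + 1 + 1)).prod 𝓘(ℝ, Plane × Plane)) b,
      (∀ j, xiForm m j (Θ.soldering b v') = Complex.I * xiForm m j (Θ.soldering b v)) →
      φ.zeta b v' = Complex.I * φ.zeta b v →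
      almostComplexStructure Θ φ χ (mfderiv ((𝓡 (2 * m + 1 + 1)).prod 𝓘(ℝ, Plane × Plane))
          𝓘(ℝ, EuclideanSpace ℝ (Fin (2 * m + 1 + 1)) × ℂ) ConfFrame.mk b v) =
        mfderiv ((𝓡 (2 * m + 1 + 1)).prod 𝓘(ℝ, Plane × Plane))
          𝓘(ℝ, EuclideanSpace ℝ (Fin (2 * m + 1 + 1)) × ℂ) ConfFrame.mk b v' := by
  refine Classical.epsilon_spec (p := fun J : TangentSpace
    𝓘(ℝ, EuclideanSpace ℝ (Fin (2 * m + 1 + 1)) × ℂ) χ →L[ℝ]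
      TangentSpace 𝓘(ℝ, EuclideanSpace ℝ (Fin (2 * m + 1 + 1)) × ℂ) χ =>
    ∃ b : FrameBundle E, ConfFrame.mk b = χ ∧
    ∀ v v' : TangentSpace ((𝓡 (2 * m + 1 + 1)).prod 𝓘(ℝ, Plane × Plane)) b,
      (∀ j, xiForm m j (Θ.soldering b v') = Complex.I * xiForm m j (Θ.soldering b v)) →
      φ.zeta b v' = Complex.I * φ.zeta b v →
      J (mfderiv ((𝓡 (2 * m + 1 + 1)).prod 𝓘(ℝ, Plane × Plane))
          𝓘(ℝ, EuclideanSpace ℝ (Fin (2 * m + 1 + 1)) × ℂ) ConfFrame.mk b v) =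
        mfderiv ((𝓡 (2 * m + 1 + 1)).prod 𝓘(ℝ, Plane × Plane))
          𝓘(ℝ, EuclideanSpace ℝ (Fin (2 * m + 1 + 1)) × ℂ) ConfFrame.mk b v') ?_
  obtain ⟨b, rfl⟩ : ∃ b, ConfFrame.mk b = χ := Quotient.exists_rep χ
  let B := mfderiv ((𝓡 (2 * m + 1 + 1)).prod 𝓘(ℝ, Plane × Plane)) (𝓡 (2 * m + 1 + 1))
        (fun c : FrameBundle E => c.1.1) b
  let D : EuclideanSpace ℝ (Fin (2 * m + 1 + 1)) × (Plane × Plane) →L[ℝ]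
      EuclideanSpace ℝ (Fin (2 * m + 1 + 1)) × ℂ :=
    mfderiv ((𝓡 (2 * m + 1 + 1)).prod 𝓘(ℝ, Plane × Plane))
          𝓘(ℝ, EuclideanSpace ℝ (Fin (2 * m + 1 + 1)) × ℂ) ConfFrame.mk b
  let Λ : EuclideanSpace ℝ (Fin (2 * m + 1 + 1)) × (Plane × Plane) →ₗ[ℝ] (Fin (m + 1) → ℂ) × ℂ :=
    LinearMap.prod ((Θ.coframe b).toLinearMap ∘ₗ B.toLinearMap) (φ.zetaLinear b)
  have hΛ : Function.Surjective Λ := by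
    rintro ⟨a, c⟩
    obtain ⟨v, h1, h2⟩ := φ.exists_mfderiv_base_eq_and_zeta_eq b ((Θ.coframe b).symm a) c
    refine ⟨v, Prod.ext ?_ h2⟩
    change Θ.coframe b (B v) = a
    rw [h1, LinearEquiv.apply_symm_apply]
  have hD : Function.Surjective D := by
    obtain ⟨w', hw, h⟩ := ConfFrame.exists_hasMFDerivAt_mk (2 * m + 1 + 1) b
    have : D = (ContinuousLinearMap.id ℝ (EuclideanSpace ℝ (Fin (2 * m + 1 + 1)))).prodMap w' :=
      h.mfderiv
    rw [this]
    exact Function.surjective_id.prodMap hw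
  have hker : LinearMap.ker Λ ≤ LinearMap.ker D.toLinearMap := by
    intro v hv
    rw [LinearMap.mem_ker] at hv
    have h1 : Θ.coframe b (B v) = 0 := congrArg Prod.fst hv
    exact φ.mfderiv_mk_eq_zero b ((Θ.coframe b).map_eq_zero_iff.1 h1) (congrArg Prod.snd hv)
  obtain ⟨J, hJ⟩ := exists_linearMap_semiconj Λ D.toLinearMap hΛ hD hker
    (by simp [Module.finrank_pi_fintype]; ring)
    ((Complex.I • LinearMap.id : (Fin (m + 1) → ℂ) × ℂ →ₗ[ℂ] _).restrictScalars ℝ)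
  let J' : EuclideanSpace ℝ (Fin (2 * m + 1 + 1)) × ℂ →L[ℝ]
    EuclideanSpace ℝ (Fin (2 * m + 1 + 1)) × ℂ := LinearMap.toContinuousLinearMap J
  refine ⟨J', b, rfl, fun v v' h1 h2 => hJ v v' (Prod.ext ?_ h2)⟩
  funext j
  exact h1 j

end Coframe

/-! ### Symmetric powers of a plane as binary forms, and linear substitutions. -/

section SymmetricProducts
open Polynomial

/-- The linear map on a symmetric power induced by a symmetric multilinear map. -/
theorem exists_symmetricPower_lift {ι : Type} {V W : Type*} [AddCommGroup V] [Module ℝ V]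
    [AddCommGroup W] [Module ℝ W] (f : MultilinearMap ℝ (fun _ : ι => V) W)
    (hf : ∀ (e : Equiv.Perm ι) (u : ι → V), f (fun i => u (e i)) = f u) :
    ∃ F : SymmetricPower ℝ ι V →ₗ[ℝ] W, ∀ u, F (SymmetricPower.tprod ℝ u) = f u := by
  let g := PiTensorProduct.lift f
  have hg : addConGen (SymmetricPower.Rel ℝ ι V) ≤ AddCon.ker g.toAddMonoidHom := by
    refine AddCon.addConGen_le.2 ?_
    rintro _ _ ⟨e, u⟩
    refine (AddCon.ker_rel _).2 ?_
    rw [LinearMap.toAddMonoidHom_coe]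
    simp only [g, PiTensorProduct.lift.tprod]
    exact (hf e u).symm
  let F := AddCon.lift (addConGen (SymmetricPower.Rel ℝ ι V)) g.toAddMonoidHom hg
  refine ⟨{ toFun := F, map_add' := map_add F, map_smul' := fun c x => ?_ }, fun u => ?_⟩
  · induction x using AddCon.induction_on with | _ x =>
    exact map_smul g c x
  · exact PiTensorProduct.lift.tprod u

variable {V : Type*} [AddCommGroup V] [Module ℝ V]

/-- The linear polynomial `s + t X` corresponding to the vector `s x + t y`, for a basis `(x, y)`. -/
noncomputable def linPoly (β : Module.Basis (Fin 2) ℝ V) : V →ₗ[ℝ] ℝ[X] where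
  toFun v := C (β.repr v 0) + C (β.repr v 1) * X
  map_add' v w := by simp only [map_add, Finsupp.add_apply]; ring
  map_smul' c v := by
    simp only [map_smul, Finsupp.smul_apply, smul_eq_mul, C_mul, RingHom.id_apply, smul_eq_C_mul]
    ring

/-- The expansion of a symmetric product in monomials. -/
theorem tprod_eq_sum_symMonomial (k : ℕ) (β : Module.Basis (Fin 2) ℝ V) (u : Fin k → V) :
    SymmetricPower.tprod ℝ u =
      ∑ i : Fin (k + 1), (∏ s, linPoly β (u s)).coeff i • symMonomial k (β 0) (β 1) i := by
  -- `F` multiplies out the linear polynomials of the factors; commutativity of the product makes it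
  -- well defined.
  obtain ⟨F, hF⟩ := exists_symmetricPower_lift
    ((MultilinearMap.mkPiAlgebra ℝ (Fin k) ℝ[X]).compLinearMap fun _ => linPoly β) (by
      intro e u
      simp only [MultilinearMap.compLinearMap_apply, MultilinearMap.mkPiAlgebra_apply]
      exact Equiv.prod_comp e fun i => linPoly β (u i))
  simp only [MultilinearMap.compLinearMap_apply, MultilinearMap.mkPiAlgebra_apply] at hF
  have hx : linPoly β (β 0) = 1 := by simp [linPoly]
  have hy : linPoly β (β 1) = X := by simp [linPoly]
  have hmon : ∀ i, F (symMonomial k (β 0) (β 1) i) = X ^ (i : ℕ) := by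
    intro i
    rw [symMonomial, hF]
    simp only [apply_ite (linPoly β), hx, hy]
    rw [Finset.prod_ite, Finset.prod_const_one, one_mul, Finset.prod_const]
    congr 1
    have h1 := Finset.card_filter_add_card_filter_not (s := (Finset.univ : Finset (Fin k)))
      (fun s : Fin k => (s : ℕ) < k - i)
    rw [Fin.card_filter_val_lt] at h1
    simp only [Finset.card_univ, Fintype.card_fin] at h1
    omega
  -- `G` rebuilds an element from the coefficients of its image under `F`. It fixes the spanning
  -- monomials, since `F` sends them to `1, X, …, X^k`, hence it is the identity.
  let G : Sym[ℝ]^k V →ₗ[ℝ] Sym[ℝ]^k V :=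
    ∑ i : Fin (k + 1), ((lcoeff ℝ i) ∘ₗ F).smulRight (symMonomial k (β 0) (β 1) i)
  have hG : G = LinearMap.id := by
    refine LinearMap.ext_on_range (span_symMonomial k β) fun j => ?_
    simp only [G, LinearMap.sum_apply, LinearMap.smulRight_apply, LinearMap.comp_apply, hmon,
      lcoeff_apply, coeff_X_pow, LinearMap.id_apply]
    rw [Finset.sum_eq_single j]
    · simp
    · intro i _ hij
      rw [if_neg (fun h => hij (Fin.ext h)), zero_smul]
    · simp
  have := LinearMap.congr_fun hG (SymmetricPower.tprod ℝ u)
  simp only [G, LinearMap.sum_apply, LinearMap.smulRight_apply, LinearMap.comp_apply, hF,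
      lcoeff_apply, LinearMap.id_apply] at this
  exact this.symm

theorem symMonomial_eq_sum_symMonomial (k : ℕ) (β : Module.Basis (Fin 2) ℝ V) (a b c d : ℝ)
    (i : Fin (k + 1)) :
    symMonomial k (a • β 0 + c • β 1) (b • β 0 + d • β 1) i =
      ∑ l : Fin (k + 1), ((C a + C c * X) ^ (k - i) * (C b + C d * X) ^ (i : ℕ) : ℝ[X]).coeff l •
        symMonomial k (β 0) (β 1) l := by
  rw [symMonomial, tprod_eq_sum_symMonomial k β]
  have hx : linPoly β (a • β 0 + c • β 1) = C a + C c * X := by simp [linPoly]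
  have hy : linPoly β (b • β 0 + d • β 1) = C b + C d * X := by simp [linPoly]
  have h1 := Finset.card_filter_add_card_filter_not (s := (Finset.univ : Finset (Fin k)))
    (fun s : Fin k => (s : ℕ) < k - i)
  have h2 : (Finset.univ.filter fun s : Fin k => (s : ℕ) < k - i).card = k - i := by
    rw [Fin.card_filter_val_lt]; omega
  have h3 : (Finset.univ.filter fun s : Fin k => ¬ (s : ℕ) < k - i).card = i := by
    simp only [Finset.card_univ, Fintype.card_fin] at h1
    omega
  simp only [apply_ite (linPoly β), hx, hy]
  rw [Finset.prod_ite, Finset.prod_const, Finset.prod_const, h2, h3]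

/-- The substitution `x ↦ A`, `y ↦ B` in the form of degree `k` whose value at `x = 1`, `y = X`
is `p`. -/
noncomputable def substForm (A B : ℂ[X]) (k : ℕ) (p : ℂ[X]) : ℂ[X] :=
  ∑ i ∈ Finset.range (k + 1), C (p.coeff i) * (A ^ (k - i) * B ^ i)

/-- Substitution is multiplicative on forms, here for a factor `x + αy`. The form has degree `k + 1`
after multiplication, and the bound on `p` makes its coefficient in degree `k + 1` vanish, so that
both sums can be indexed alike. -/
theorem substForm_mul (A B : ℂ[X]) {k : ℕ} {p : ℂ[X]} (hp : p.natDegree ≤ k) (α : ℂ) :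
    substForm A B (k + 1) ((1 + C α * X) * p) = (A + C α * B) * substForm A B k p := by
  have hc : ∀ i, ((1 + C α * X) * p).coeff (i + 1) = p.coeff (i + 1) + α * p.coeff i := by
    intro i
    rw [add_mul, one_mul, mul_assoc, coeff_add, coeff_C_mul, coeff_X_mul]
  have hc0 : ((1 + C α * X) * p).coeff 0 = p.coeff 0 := by
    simp [mul_coeff_zero]
  have h1 : A * substForm A B k p =
      ∑ i ∈ Finset.range (k + 1 + 1), C (p.coeff i) * (A ^ (k + 1 - i) * B ^ i) := by
    rw [Finset.sum_range_succ, coeff_eq_zero_of_natDegree_lt (by omega : p.natDegree < k + 1),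
      C_0, zero_mul, add_zero, substForm, Finset.mul_sum]
    refine Finset.sum_congr rfl fun i hi => ?_
    rw [Finset.mem_range] at hi
    rw [show k + 1 - i = k - i + 1 by omega]
    ring
  rw [add_mul A, h1, substForm, Finset.sum_range_succ', Finset.sum_range_succ' _ (k + 1), hc0,
    substForm, Finset.mul_sum, add_right_comm, ← Finset.sum_add_distrib]
  congr 1
  refine Finset.sum_congr rfl fun i hi => ?_
  rw [hc, C_add, C_mul, Nat.add_sub_add_right]
  ring

theorem natDegree_zP_pow_mul_le (a b : ℕ) : (zP ^ a * zbarP ^ b).natDegree ≤ a + b := by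
  have h1 : zP.natDegree ≤ 1 := by unfold zP; compute_degree
  have h2 : zbarP.natDegree ≤ 1 := by unfold zbarP; compute_degree
  calc _ ≤ (zP ^ a).natDegree + (zbarP ^ b).natDegree := natDegree_mul_le
    _ ≤ a * 1 + b * 1 := add_le_add (natDegree_pow_le_of_le a h1) (natDegree_pow_le_of_le b h2)
    _ = a + b := by ring

/-- The factors `z` and `z̄` become `A + iB` and `A - iB`; they are added one at a time. -/
theorem substForm_zP_zbarP (A B : ℂ[X]) (a b : ℕ) :
    substForm A B (a + b) (zP ^ a * zbarP ^ b) =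
      (A + C Complex.I * B) ^ a * (A - C Complex.I * B) ^ b := by
  induction b with
  | zero =>
    induction a with
    | zero => simp [substForm]
    | succ a ih =>
      have h := substForm_mul A B (natDegree_zP_pow_mul_le a 0) Complex.I
      rw [ih] at h
      rw [add_right_comm, show zP ^ (a + 1) * zbarP ^ 0 =
        (1 + C Complex.I * X) * (zP ^ a * zbarP ^ 0) by rw [← zP]; ring, h]
      ring
  | succ b ih =>
    have h := substForm_mul A B (natDegree_zP_pow_mul_le a b) (-Complex.I)
    rw [ih] at h
    rw [← add_assoc, show zP ^ a * zbarP ^ (b + 1) =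
      (1 + C (-Complex.I) * X) * (zP ^ a * zbarP ^ b) by
        rw [C_neg, neg_mul, ← sub_eq_add_neg, ← zbarP]; ring, h, C_neg]
    ring

end SymmetricProducts

/-! ### The action of `CO(2)` on the monomials `z^(k-j) z̄^j`. -/

section Frames
open Polynomial

variable {k : ℕ} {M : Type*} [TopologicalSpace M]
  [ChartedSpace (EuclideanSpace ℝ (Fin (k + 1))) M] [IsManifold (𝓡 (k + 1)) ∞ M]
  {E : M → Type*} [∀ p, AddCommGroup (E p)] [∀ p, Module ℝ (E p)] [∀ p, TopologicalSpace (E p)]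
  [TopologicalSpace (TotalSpace Plane E)] [FiberBundle Plane E] [VectorBundle ℝ Plane E]

theorem FrameBundle.exists_basis (b : FrameBundle E) :
    ∃ β : Module.Basis (Fin 2) ℝ (E b.1.1), β 0 = b.1.2.1 ∧ β 1 = b.1.2.2 := by
  have hr : Module.finrank ℝ (E b.1.1) = 2 := by
    rw [((trivializationAt Plane E b.1.1).linearEquivAt ℝ b.1.1
      (mem_baseSet_trivializationAt Plane E b.1.1)).finrank_eq]
    simp
  have hb : LinearIndependent ℝ ![b.1.2.1, b.1.2.2] := b.2
  exact ⟨basisOfLinearIndependentOfCardEqFinrank hb (by simp [hr]), by simp, by simp⟩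

theorem GL2Structure.frame_apply (Θ : GL2Structure k E) (b : FrameBundle E) (i : Fin (k + 1)) :
    Θ.frame b i = (Θ.iso b.1.1).symm (symMonomial k b.1.2.1 b.1.2.2 i) := by
  simp [GL2Structure.frame]

theorem GL2Structure.frame_act (Θ : GL2Structure k E) (b : FrameBundle E) (g : GL (Fin 2) ℝ)
    (i : Fin (k + 1)) :
    (Θ.frame (b.act g) i : TangentSpace (𝓡 (k + 1)) b.1.1) =
      ∑ l : Fin (k + 1), ((C (g 0 0) + C (g 1 0) * X) ^ (k - i) *
        (C (g 0 1) + C (g 1 1) * X) ^ (i : ℕ) : ℝ[X]).coeff l • Θ.frame b l := by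
  obtain ⟨β, h0, h1⟩ := b.exists_basis
  simp only [GL2Structure.frame_apply, ← h0, ← h1, ← map_smul, ← map_sum,
    ← symMonomial_eq_sum_symMonomial]
  rw [h0, h1]
  rfl

/-- Under `(x, y) ↦ (x, y) g` with `g` in `CO(2)`, the vector `z` becomes `cz` and `z̄` becomes
`c̄z̄`, where `c = g₀₀ + i g₀₁`. -/
theorem GL2Structure.zMonomial_act (Θ : GL2Structure k E) (b : FrameBundle E) {g : GL (Fin 2) ℝ}
    (hg : g ∈ CO2) {j : ℕ} (hj : j ≤ k) :
    (Θ.zMonomial (b.act g) j : ℂ ⊗[ℝ] TangentSpace (𝓡 (k + 1)) b.1.1) =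
      ((⟨g 0 0, g 0 1⟩ : ℂ) ^ (k - j) * (⟨g 0 0, -g 0 1⟩ : ℂ) ^ j) • Θ.zMonomial b j := by
  obtain ⟨hg1, hg2⟩ := hg
  set p : ℂ[X] := zP ^ (k - j) * zbarP ^ j with hp
  set A : ℝ[X] := C (g 0 0) + C (g 1 0) * X with hA
  set B : ℝ[X] := C (g 0 1) + C (g 1 1) * X with hB
  set c : ℂ := ⟨g 0 0, g 0 1⟩ with hc
  set c' : ℂ := ⟨g 0 0, -g 0 1⟩ with hc'
  -- `A` and `B` are the new basis vectors in the old coordinates, so this substitution rewrites the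
  -- new monomial in the old frame.
  have hsub : substForm (A.map Complex.ofRealHom) (B.map Complex.ofRealHom) k p =
      C (c ^ (k - j) * c' ^ j) * p := by
    have h1 := substForm_zP_zbarP (A.map Complex.ofRealHom) (B.map Complex.ofRealHom) (k - j) j
    rw [Nat.sub_add_cancel hj] at h1
    have h2 : A.map Complex.ofRealHom + C Complex.I * B.map Complex.ofRealHom = C c * zP := by
      ext n
      simp only [hA, hB, zP, Polynomial.map_add, Polynomial.map_mul, map_C, map_X, coeff_add,
        coeff_C_mul, coeff_C, coeff_X, coeff_one]
      rcases n with _ | _ | n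
      · apply Complex.ext <;> simp [hc]
      · apply Complex.ext <;> simp [hc, hg1, hg2]
      · simp
    have h3 : A.map Complex.ofRealHom - C Complex.I * B.map Complex.ofRealHom = C c' * zbarP := by
      ext n
      simp only [hA, hB, zbarP, Polynomial.map_add, Polynomial.map_mul, map_C, map_X, coeff_add,
        coeff_sub, coeff_C_mul, coeff_C, coeff_X, coeff_one]
      rcases n with _ | _ | n
      · apply Complex.ext <;> simp [hc']
      · apply Complex.ext <;> simp [hc', hg1, hg2]
      · simp
    rw [h1, h2, h3, mul_pow, mul_pow, C_mul, C_pow, C_pow]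
    ring
  -- The base points of `b.act g` and `b` agree by definition; naming the space lets both sides be
  -- compared in it.
  let T := ℂ ⊗[ℝ] TangentSpace (𝓡 (k + 1)) b.1.1
  change @Eq T _ _
  calc (show T from Θ.zMonomial (b.act g) j)
      = ∑ i : Fin (k + 1), p.coeff i ⊗ₜ[ℝ] ∑ l : Fin (k + 1),
          (A ^ (k - i) * B ^ (i : ℕ)).coeff l • Θ.frame b l := by
        refine Finset.sum_congr rfl fun i _ => ?_
        rw [← GL2Structure.frame_act]
        rfl
    _ = ∑ l : Fin (k + 1), (substForm (A.map Complex.ofRealHom) (B.map Complex.ofRealHom) k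
          p).coeff l ⊗ₜ[ℝ] Θ.frame b l := by
        simp only [TensorProduct.tmul_sum]
        rw [Finset.sum_comm]
        refine Finset.sum_congr rfl fun l _ => ?_
        rw [substForm, Finset.sum_range, finsetSum_coeff, TensorProduct.sum_tmul]
        refine Finset.sum_congr rfl fun i _ => ?_
        rw [TensorProduct.tmul_smul, TensorProduct.smul_tmul', coeff_C_mul, ← Polynomial.map_pow,
          ← Polynomial.map_pow, ← Polynomial.map_mul, coeff_map, Complex.real_smul,
          mul_comm]
        rfl
    _ = _ := by
        rw [hsub, GL2Structure.zMonomial, Finset.smul_sum]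
        refine Finset.sum_congr rfl fun l _ => ?_
        rw [coeff_C_mul, TensorProduct.smul_tmul']
        rfl

end Frames

/-! ### The coframe and the space of `(0,1)`-vectors of `J_z`. -/

section ComplexStructure
open Polynomial

variable {m : ℕ} {M : Type*} [TopologicalSpace M]
  [ChartedSpace (EuclideanSpace ℝ (Fin (2 * m + 1 + 1))) M]
  [IsManifold (𝓡 (2 * m + 1 + 1)) ∞ M]
  {E : M → Type*} [∀ p, AddCommGroup (E p)] [∀ p, Module ℝ (E p)] [∀ p, TopologicalSpace (E p)]
  [TopologicalSpace (TotalSpace Plane E)] [FiberBundle Plane E] [VectorBundle ℝ Plane E]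

theorem evenOddBasis_apply (m : ℕ) (i : Fin (m + 1) ⊕ Fin (m + 1)) :
    evenOddBasis m i = evenOddVec m i := by
  simp [evenOddBasis]

theorem xiEquiv_evenOddVec_inl (m : ℕ) (j : Fin (m + 1)) :
    xiEquiv m (evenOddVec m (Sum.inl j)) = Pi.single j 1 := by
  funext i
  rw [xiEquiv_apply, ← evenOddBasis_apply, xiForm, Module.Basis.repr_self, Pi.single_apply]
  split_ifs with h
  · subst h; apply Complex.ext <;> simp
  · apply Complex.ext <;> simp [Ne.symm h]

theorem xiEquiv_evenOddVec_inr (m : ℕ) (j : Fin (m + 1)) :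
    xiEquiv m (evenOddVec m (Sum.inr j)) = Pi.single j Complex.I := by
  funext i
  rw [xiEquiv_apply, ← evenOddBasis_apply, xiForm, Module.Basis.repr_self, Pi.single_apply]
  split_ifs with h
  · subst h; apply Complex.ext <;> simp
  · apply Complex.ext <;> simp [Ne.symm h]

/-- The tangent vectors `V_{k,j}^{even}`, `V_{k,j}^{odd}` given by a frame. -/
noncomputable def GL2Structure.evenOddTangent (Θ : GL2Structure (2 * m + 1) E)
    (b : FrameBundle E) :
    Module.Basis (Fin (m + 1) ⊕ Fin (m + 1)) ℝ (TangentSpace (𝓡 (2 * m + 1 + 1)) b.1.1) :=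
  (evenOddBasis m).map (Θ.frame b).equivFun.symm

theorem GL2Structure.coframe_evenOddTangent (Θ : GL2Structure (2 * m + 1) E) (b : FrameBundle E)
    (i : Fin (m + 1) ⊕ Fin (m + 1)) :
    Θ.coframe b (Θ.evenOddTangent b i) = xiEquiv m (evenOddVec m i) := by
  rw [GL2Structure.evenOddTangent, Module.Basis.map_apply, evenOddBasis_apply,
    GL2Structure.coframe, LinearEquiv.trans_apply, LinearEquiv.apply_symm_apply]

/-- This is `(z z̄)^j z^(k-2j) = V_j^even + i V_j^odd`, transported to the tangent space by the
frame. -/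
theorem GL2Structure.zMonomial_eq (Θ : GL2Structure (2 * m + 1) E) (b : FrameBundle E)
    (j : Fin (m + 1)) :
    Θ.zMonomial b j = (1 : ℂ) ⊗ₜ[ℝ] Θ.evenOddTangent b (Sum.inl j) +
      Complex.I ⊗ₜ[ℝ] Θ.evenOddTangent b (Sum.inr j) := by
  have h : ∀ i : Fin (2 * m + 1 + 1), (zP ^ (2 * m + 1 - (j : ℕ)) * zbarP ^ (j : ℕ)).coeff i =
      evenOddVec m (Sum.inl j) i • (1 : ℂ) + evenOddVec m (Sum.inr j) i • Complex.I := by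
    intro i
    rw [← evenV_add _ _ (by omega), coeff_add, coeff_C_mul, coeff_map, coeff_map]
    simp [evenOddVec, coeffVec, mul_comm]
  simp only [GL2Structure.zMonomial, h, TensorProduct.add_tmul, Finset.sum_add_distrib,
    TensorProduct.smul_tmul, GL2Structure.evenOddTangent, Module.Basis.map_apply,
    evenOddBasis_apply, Module.Basis.equivFun_symm_apply, TensorProduct.tmul_sum]

theorem exists_one_tmul_add_I_tmul {V : Type*} [AddCommGroup V] [Module ℝ V] (t : ℂ ⊗[ℝ] V) :
    ∃ a c : V, t = (1 : ℂ) ⊗ₜ[ℝ] a + Complex.I ⊗ₜ[ℝ] c := by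
  induction t using TensorProduct.induction_on with
  | zero => exact ⟨0, 0, by simp⟩
  | tmul z v =>
    refine ⟨z.re • v, z.im • v, ?_⟩
    rw [← TensorProduct.smul_tmul, ← TensorProduct.smul_tmul, ← TensorProduct.add_tmul]
    congr 1
    apply Complex.ext <;> simp
  | add s t hs ht =>
    obtain ⟨a, c, rfl⟩ := hs
    obtain ⟨a', c', rfl⟩ := ht
    refine ⟨a + a', c + c', ?_⟩
    simp only [TensorProduct.tmul_add]
    abel

theorem I_smul_tmul_add {V : Type*} [AddCommGroup V] [Module ℝ V] (a c : V) :
    Complex.I • ((1 : ℂ) ⊗ₜ[ℝ] a + Complex.I ⊗ₜ[ℝ] c) =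
      (1 : ℂ) ⊗ₜ[ℝ] (-c) + Complex.I ⊗ₜ[ℝ] a := by
  rw [smul_add, TensorProduct.smul_tmul', TensorProduct.smul_tmul', smul_eq_mul, smul_eq_mul,
    mul_one, Complex.I_mul_I, TensorProduct.neg_tmul, TensorProduct.tmul_neg, add_comm]

/-- The coframe sends `V_j^even` to the `j`-th unit vector and `V_j^odd` to `i` times it, so `J`
sends `V_j^even` to `V_j^odd` and `V_j^odd` to `-V_j^even`. Hence `V_j^even + i V_j^odd` is an
eigenvector for `-i`, and these vectors span the eigenspace. -/
theorem GL2Structure.isComplexStructureAt_of_coframe (Θ : GL2Structure (2 * m + 1) E)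
    (b : FrameBundle E)
    {J : TangentSpace (𝓡 (2 * m + 1 + 1)) b.1.1 →L[ℝ] TangentSpace (𝓡 (2 * m + 1 + 1)) b.1.1}
    (hJ : ∀ v, Θ.coframe b (J v) = Complex.I • Θ.coframe b v) :
    Θ.IsComplexStructureAt b J := by
  have hJJ : ∀ v, J (J v) = -v := fun v => by
    apply (Θ.coframe b).injective
    rw [hJ, hJ, smul_smul, Complex.I_mul_I, map_neg, neg_one_smul]
  have he : ∀ j, J (Θ.evenOddTangent b (Sum.inl j)) = Θ.evenOddTangent b (Sum.inr j) := fun j => by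
    apply (Θ.coframe b).injective
    rw [hJ, Θ.coframe_evenOddTangent, Θ.coframe_evenOddTangent, xiEquiv_evenOddVec_inl,
      xiEquiv_evenOddVec_inr, ← Pi.single_smul, smul_eq_mul, mul_one]
  have ho : ∀ j, J (Θ.evenOddTangent b (Sum.inr j)) = -Θ.evenOddTangent b (Sum.inl j) :=
    fun j => by rw [← he, hJJ]
  refine ⟨hJJ, le_antisymm ?_ ?_⟩
  · intro t ht
    rw [Module.End.mem_eigenspace_iff] at ht
    obtain ⟨a, c, rfl⟩ := exists_one_tmul_add_I_tmul t
    rw [map_add, LinearMap.baseChange_tmul, LinearMap.baseChange_tmul, neg_smul,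
      I_smul_tmul_add, neg_add, ← TensorProduct.tmul_neg, ← TensorProduct.tmul_neg, neg_neg] at ht
    obtain ⟨h1, -⟩ := one_tmul_add_I_tmul_injective ht
    obtain rfl : J a = c := h1
    -- Every `(-i)`-eigenvector is `L a = a + i J a` with `a` real. As `L` is real linear, it
    -- suffices to test a real basis: `V_j^even` gives `z^(k-j) z̄^j` and `V_j^odd` gives `-i` times
    -- it.
    let S := (Submodule.span ℂ (Set.range fun j : Fin (m + 1) => Θ.zMonomial b j)).restrictScalars ℝ
    let L : TangentSpace (𝓡 (2 * m + 1 + 1)) b.1.1 →ₗ[ℝ]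
        ℂ ⊗[ℝ] TangentSpace (𝓡 (2 * m + 1 + 1)) b.1.1 :=
      TensorProduct.mk ℝ ℂ _ 1 + TensorProduct.mk ℝ ℂ _ Complex.I ∘ₗ J.toLinearMap
    suffices h : ⊤ ≤ S.comap L from h (Submodule.mem_top (x := a))
    rw [← (Θ.evenOddTangent b).span_eq, Submodule.span_le]
    rintro _ ⟨j | j, rfl⟩
    · change (1 : ℂ) ⊗ₜ[ℝ] _ + Complex.I ⊗ₜ[ℝ] J _ ∈ Submodule.span ℂ _
      rw [he, ← Θ.zMonomial_eq]
      exact Submodule.subset_span ⟨j, rfl⟩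
    · change (1 : ℂ) ⊗ₜ[ℝ] _ + Complex.I ⊗ₜ[ℝ] J _ ∈ Submodule.span ℂ _
      have h := Submodule.smul_mem _ (-Complex.I) (Submodule.subset_span (R := ℂ)
        (s := Set.range fun j : Fin (m + 1) => Θ.zMonomial b j) ⟨j, rfl⟩)
      simp only [Θ.zMonomial_eq, neg_smul, I_smul_tmul_add] at h
      rw [neg_add, ← TensorProduct.tmul_neg, ← TensorProduct.tmul_neg, neg_neg] at h
      rw [ho]
      simpa only [Θ.zMonomial_eq] using h
  · rw [Submodule.span_le]
    rintro _ ⟨j, rfl⟩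
    rw [SetLike.mem_coe, Module.End.mem_eigenspace_iff]
    simp only [Θ.zMonomial_eq]
    rw [map_add, LinearMap.baseChange_tmul, LinearMap.baseChange_tmul, neg_smul,
      I_smul_tmul_add, neg_add, ← TensorProduct.tmul_neg, ← TensorProduct.tmul_neg, neg_neg]
    congr 2
    · exact he j
    · exact ho j

/-- Each spanning vector is multiplied by a nonzero complex number, so the space of `(0,1)`-vectors
depends only on the class of `b`. -/
theorem GL2Structure.isComplexStructureAt_act (Θ : GL2Structure (2 * m + 1) E)
    (b : FrameBundle E) {g : GL (Fin 2) ℝ} (hg : g ∈ CO2)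
    {J : TangentSpace (𝓡 (2 * m + 1 + 1)) b.1.1 →L[ℝ] TangentSpace (𝓡 (2 * m + 1 + 1)) b.1.1}
    (hJ : Θ.IsComplexStructureAt b J) : Θ.IsComplexStructureAt (b.act g) J := by
  refine ⟨hJ.1, ?_⟩
  refine hJ.2.trans ?_
  have hne : (⟨g 0 0, g 0 1⟩ : ℂ) ≠ 0 := by
    have := CO2.complex_ne_zero hg
    rwa [← hg.2] at this
  have hne' : (⟨g 0 0, -g 0 1⟩ : ℂ) ≠ 0 := by
    intro h
    have h1 := congrArg Complex.re h
    have h2 := congrArg Complex.im h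
    simp at h1 h2
    exact hne (Complex.ext h1 h2)
  let T := ℂ ⊗[ℝ] TangentSpace (𝓡 (2 * m + 1 + 1)) b.1.1
  change Submodule.span ℂ (Set.range fun j : Fin (m + 1) => Θ.zMonomial b j) =
    Submodule.span ℂ (Set.range fun j : Fin (m + 1) => (show T from Θ.zMonomial (b.act g) j))
  have h := fun j : Fin (m + 1) =>
    Θ.zMonomial_act b hg (show (j : ℕ) ≤ 2 * m + 1 by have := j.2; omega)
  refine le_antisymm (Submodule.span_le.2 ?_) (Submodule.span_le.2 ?_)
  · rintro _ ⟨j, rfl⟩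
    have hc := mul_ne_zero (pow_ne_zero (2 * m + 1 - (j : ℕ)) hne) (pow_ne_zero (j : ℕ) hne')
    have h1 : Θ.zMonomial b j = ((⟨g 0 0, g 0 1⟩ : ℂ) ^ (2 * m + 1 - (j : ℕ)) *
        (⟨g 0 0, -g 0 1⟩ : ℂ) ^ (j : ℕ))⁻¹ • (show T from Θ.zMonomial (b.act g) j) :=
      ((congrArg _ (h j)).trans (inv_smul_smul₀ hc _)).symm
    rw [SetLike.mem_coe]
    simp only [h1]
    exact Submodule.smul_mem _ _ (Submodule.subset_span ⟨j, rfl⟩)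
  · rintro _ ⟨j, rfl⟩
    have h1 := Submodule.smul_mem _ ((⟨g 0 0, g 0 1⟩ : ℂ) ^ (2 * m + 1 - (j : ℕ)) *
        (⟨g 0 0, -g 0 1⟩ : ℂ) ^ (j : ℕ)) (Submodule.subset_span (R := ℂ)
        (s := Set.range fun j : Fin (m + 1) => Θ.zMonomial b j) ⟨j, rfl⟩)
    exact Set.mem_of_eq_of_mem (h j) h1

end ComplexStructure

/-! ### A point of `B(E)/CO(2)` is determined by its complex line. -/

section Lines

variable {M : Type*} [TopologicalSpace M]
  {E : M → Type*} [∀ p, AddCommGroup (E p)] [∀ p, Module ℝ (E p)] [∀ p, TopologicalSpace (E p)]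
  [TopologicalSpace (TotalSpace Plane E)] [FiberBundle Plane E] [VectorBundle ℝ Plane E]

/-- If `x' + iy' = a(x + iy)`, then `a`, read as a matrix of `CO(2)`, takes `(x, y)` to `(x', y')`;
real and imaginary parts in `ℂ ⊗ E_p` are unique. -/
theorem FrameBundle.mk_eq_mk_of_line_eq {b b' : FrameBundle E} (h : b.line = b'.line) :
    ConfFrame.mk b = ConfFrame.mk b' := by
  have h' : b.line.1 = b'.line.1 := congrArg Subtype.val h
  clear h
  obtain ⟨⟨p, x, y⟩, hb⟩ := b
  obtain ⟨⟨p', x', y'⟩, hb'⟩ := b'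
  obtain rfl : p = p' := congrArg Sigma.fst h'
  have h1 := eq_of_heq (Sigma.mk.inj h').2
  obtain ⟨a, ha⟩ := (Projectivization.mk_eq_mk_iff' ℂ _ _ _ _).1 h1.symm
  have ha' : a • ((1 : ℂ) ⊗ₜ[ℝ] x + Complex.I ⊗ₜ[ℝ] y) =
    (1 : ℂ) ⊗ₜ[ℝ] x' + Complex.I ⊗ₜ[ℝ] y' := ha
  have ha0 : a ≠ 0 := by
    rintro rfl
    rw [zero_smul] at ha
    exact FrameBundle.zVec_ne_zero (E := E) _ ha.symm
  let A : Matrix (Fin 2) (Fin 2) ℝ := !![a.re, a.im; -a.im, a.re]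
  have hA : A.det ≠ 0 := by
    rw [Matrix.det_fin_two_of]
    have : Complex.normSq a ≠ 0 := by simpa using ha0
    rw [Complex.normSq_apply] at this
    intro h; apply this; linear_combination h
  have hg : Matrix.GeneralLinearGroup.mkOfDetNeZero A hA ∈ CO2 := ⟨by simp [A], by simp [A]⟩
  refine ConfFrame.mk_eq_mk.2 ⟨_, hg, ?_⟩
  have h2 := FrameBundle.zVec_act (E := E) ⟨⟨p, x, y⟩, hb⟩ hg
  have h3 : (⟨Matrix.GeneralLinearGroup.mkOfDetNeZero A hA 0 0,
      -Matrix.GeneralLinearGroup.mkOfDetNeZero A hA 1 0⟩ : ℂ) = a := by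
    apply Complex.ext <;> simp [A]
  rw [h3] at h2
  obtain ⟨hx, hy⟩ := one_tmul_add_I_tmul_injective (ha'.symm.trans h2.symm)
  exact Subtype.ext (congrArg (TotalSpace.mk p) (Prod.ext hx hy))

end Lines

/-! ### The inverse function theorem on a manifold. -/

section InverseFunction

variable {V W N : Type*} [NormedAddCommGroup V] [NormedSpace ℝ V] [CompleteSpace V]
  [NormedAddCommGroup W] [NormedSpace ℝ W]
  [TopologicalSpace N] [ChartedSpace V N] [IsManifold 𝓘(ℝ, V) ∞ N]

/-- The inverse function theorem for a smooth map from a manifold to a vector space. -/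
theorem exists_openPartialHomeomorph_of_hasMFDerivAt {G : N → W} {U : Set N} (hU : IsOpen U)
    (hG : ContMDiffOn 𝓘(ℝ, V) 𝓘(ℝ, W) ∞ G U) {x : N} (hx : x ∈ U) {G' : V ≃L[ℝ] W}
    (hG' : HasMFDerivAt 𝓘(ℝ, V) 𝓘(ℝ, W) G x (G' : V →L[ℝ] W)) :
    ∃ e : OpenPartialHomeomorph N W, x ∈ e.source ∧ e.source ⊆ U ∧ Set.EqOn e G e.source ∧
      ContMDiffOn 𝓘(ℝ, V) 𝓘(ℝ, W) ∞ e e.source ∧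
      ContMDiffOn 𝓘(ℝ, W) 𝓘(ℝ, V) ∞ e.symm e.target := by
  set c := chartAt V x with hc
  have hxc : x ∈ c.source := mem_chart_source V x
  set f : V → W := G ∘ c.symm with hf
  set O : Set V := c.target ∩ c.symm ⁻¹' U with hO
  have hOo : IsOpen O := c.symm.isOpen_inter_preimage hU
  have hfO : ContDiffOn ℝ ∞ f O := by
    refine contMDiffOn_iff_contDiffOn.1 (hG.comp (t := U) (s := O) ?_ fun u hu => hu.2)
    exact (contMDiffOn_chart_symm (I := 𝓘(ℝ, V)) (H := V) (n := ∞) (x := x)).mono fun u hu => hu.1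
  have hxO : c x ∈ O := ⟨c.map_source hxc, by simpa [c.left_inv hxc] using hx⟩
  have hfx : ContDiffAt ℝ ∞ f (c x) := hfO.contDiffAt (hOo.mem_nhds hxO)
  have hf' : HasFDerivAt f (G' : V →L[ℝ] W) (c x) := by
    have h := hG'.2
    simp only [writtenInExtChartAt, mfld_simps] at h
    exact h.hasFDerivAt Filter.univ_mem
  have hne : (∞ : WithTop ℕ∞) ≠ 0 := by simp
  let h := hfx.toOpenPartialHomeomorph f hf' hne
  -- Smoothness of the inverse on the whole target needs an invertible derivative at every point of
  -- the source, not only at `x`. Invertible maps form an open set, so shrinking to `O'` achieves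
  -- this.
  have hev : ∀ᶠ u in nhds (c x),
      fderiv ℝ f u ∈ Set.range ((↑) : (V ≃L[ℝ] W) → V →L[ℝ] W) := by
    have h1 : ContinuousAt (fderiv ℝ f) (c x) :=
      (hfx.fderiv_right (m := 0) (by simp)).continuousAt
    refine h1 ?_
    rw [hf'.fderiv]
    exact ContinuousLinearEquiv.nhds G'
  obtain ⟨O', hO's, hO'o, hxO'⟩ := mem_nhds_iff.1 (hev.and (hOo.mem_nhds hxO))
  let e := c.trans (h.restrOpen O' hO'o)
  have hes : ∀ y ∈ e.source, y ∈ c.source ∧ c y ∈ O' := by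
    intro y hy
    rw [OpenPartialHomeomorph.trans_source] at hy
    exact ⟨hy.1, hy.2.2⟩
  have heU : e.source ⊆ U := fun y hy => by
    have h1 := (hO's (hes y hy).2).2.2
    rwa [Set.mem_preimage, c.left_inv (hes y hy).1] at h1
  have heG : Set.EqOn e G e.source := fun y hy => by
    change G (c.symm (c y)) = G y
    rw [c.left_inv (hes y hy).1]
  refine ⟨e, ?_, heU, heG, (hG.mono heU).congr heG, ?_⟩
  · rw [OpenPartialHomeomorph.trans_source]
    exact ⟨hxc, hfx.mem_toOpenPartialHomeomorph_source hf' hne, hxO'⟩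
  · have hsymm : ContDiffOn ℝ ∞ (h.restrOpen O' hO'o).symm (h.restrOpen O' hO'o).target := by
      intro w hw
      have hu := (h.restrOpen O' hO'o).map_target hw
      obtain ⟨⟨D, hD⟩, hu2⟩ := hO's hu.2
      have hd : ContDiffAt ℝ ∞ f ((h.restrOpen O' hO'o).symm w) :=
        hfO.contDiffAt (hOo.mem_nhds hu2)
      have hd' : HasFDerivAt f (D : V →L[ℝ] W) ((h.restrOpen O' hO'o).symm w) := by
        rw [hD]
        exact (hd.differentiableAt hne).hasFDerivAt
      exact ((h.restrOpen O' hO'o).contDiffAt_symm hw hd' hd).contDiffWithinAt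
    refine ContMDiffOn.comp (t := c.target) (contMDiffOn_chart_symm (I := 𝓘(ℝ, V)) (H := V))
      ((contMDiffOn_iff_contDiffOn.2 hsymm).mono fun w hw => ?_) fun w hw => ?_
    · rw [OpenPartialHomeomorph.trans_target] at hw
      exact hw.1
    · rw [OpenPartialHomeomorph.trans_target] at hw
      exact hw.2

end InverseFunction

/-! ### Immersed complex submanifolds. -/

section ComplexSubmanifold

variable {V W N P : Type*} [NormedAddCommGroup V] [NormedSpace ℝ V] [FiniteDimensional ℝ V]
  [NormedAddCommGroup W] [NormedSpace ℝ W]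
  [TopologicalSpace N] [ChartedSpace V N] [IsManifold 𝓘(ℝ, V) ∞ N]
  [TopologicalSpace P] [ChartedSpace W P]

/-- An almost-complex structure on an immersed submanifold which is induced by an integrable one
is integrable. -/
theorem IsIntegrable.of_immersion
    {J : ∀ x : N, TangentSpace 𝓘(ℝ, V) x →L[ℝ] TangentSpace 𝓘(ℝ, V) x}
    {J' : ∀ x : P, TangentSpace 𝓘(ℝ, W) x →L[ℝ] TangentSpace 𝓘(ℝ, W) x}
    (hJ' : IsIntegrable J') {σ : N → P} (hσ : ContMDiff 𝓘(ℝ, V) 𝓘(ℝ, W) ∞ σ)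
    (hinj : ∀ x, Function.Injective (mfderiv 𝓘(ℝ, V) 𝓘(ℝ, W) σ x))
    (hJ : ∀ x v, mfderiv 𝓘(ℝ, V) 𝓘(ℝ, W) σ x (J x v) =
      J' (σ x) (mfderiv 𝓘(ℝ, V) 𝓘(ℝ, W) σ x v)) :
    IsIntegrable J := by
  intro x
  have hne : (∞ : WithTop ℕ∞) ≠ 0 := by simp
  obtain ⟨d, e, hxe, he, hes, heJ⟩ := hJ' (σ x)
  set U : Set N := σ ⁻¹' e.source with hU
  have hUo : IsOpen U := e.open_source.preimage hσ.continuous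
  have hed : ∀ z ∈ e.source, MDifferentiableAt 𝓘(ℝ, W) 𝓘(ℝ, Fin d → ℂ) e z := fun z hz =>
    (he.contMDiffAt (e.open_source.mem_nhds hz)).mdifferentiableAt hne
  have heinj : ∀ z ∈ e.source, Function.Injective (mfderiv 𝓘(ℝ, W) 𝓘(ℝ, Fin d → ℂ) e z) := by
    intro z hz
    have h1 : MDifferentiableAt 𝓘(ℝ, Fin d → ℂ) 𝓘(ℝ, W) e.symm (e z) :=
      (hes.contMDiffAt (e.open_target.mem_nhds (e.map_source hz))).mdifferentiableAt hne
    have h2 := mfderiv_comp z h1 (hed z hz)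
    have h3 : e.symm ∘ e =ᶠ[nhds z] id := by
      filter_upwards [e.open_source.mem_nhds hz] with y hy using e.left_inv hy
    rw [h3.mfderiv_eq, mfderiv_id] at h2
    intro v w hvw
    have h4 := DFunLike.congr_fun h2 v
    have h5 := DFunLike.congr_fun h2 w
    exact h4.trans ((congrArg (mfderiv 𝓘(ℝ, Fin d → ℂ) 𝓘(ℝ, W) e.symm (e z)) hvw).trans h5.symm)
  -- The derivative of `e ∘ σ` is injective and intertwines `J` with `i`.
  have hF : ∀ y ∈ U, ∃ D : V →L[ℝ] (Fin d → ℂ), HasMFDerivAt 𝓘(ℝ, V) 𝓘(ℝ, Fin d → ℂ) (e ∘ σ) y D ∧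
      Function.Injective D ∧ ∀ v, D (J y v) = Complex.I • D v := by
    intro y hy
    refine ⟨(mfderiv 𝓘(ℝ, W) 𝓘(ℝ, Fin d → ℂ) e (σ y)).comp (mfderiv 𝓘(ℝ, V) 𝓘(ℝ, W) σ y),
      (hed _ hy).hasMFDerivAt.comp y (hσ.mdifferentiable hne y).hasMFDerivAt,
      (heinj _ hy).comp (hinj y), fun v => ?_⟩
    funext i
    exact (congrArg (fun u => mfderiv 𝓘(ℝ, W) 𝓘(ℝ, Fin d → ℂ) e (σ y) u i) (hJ y v)).trans
      (heJ _ hy _ i)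
  obtain ⟨D, hD, hDinj, hDJ⟩ := hF x hxe
  -- The image of the real map `D` is stable under `i` because `i D(v) = D(J v)`.
  let S : Submodule ℂ (Fin d → ℂ) :=
    { carrier := Set.range D
      add_mem' := by
        rintro _ _ ⟨v, rfl⟩ ⟨w, rfl⟩
        exact ⟨v + w, map_add D v w⟩
      zero_mem' := ⟨0, map_zero D⟩
      smul_mem' := by
        rintro a _ ⟨v, rfl⟩
        let v' : V := J x v
        refine ⟨a.re • v + a.im • v', ?_⟩
        rw [map_add, map_smul, map_smul, hDJ v]
        funext i
        simp only [Pi.add_apply, Pi.smul_apply, smul_eq_mul, Complex.real_smul]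
        rw [← mul_assoc, ← add_mul, Complex.re_add_im] }
  -- A complex linear projection onto the tangent space `S` at `x`, followed by coordinates of `S`,
  -- makes the derivative at `x` bijective.
  obtain ⟨p, hp⟩ := S.subtype.exists_leftInverse_of_injective S.ker_subtype
  let q : (Fin d → ℂ) →ₗ[ℂ] (Fin (Module.finrank ℂ S) → ℂ) :=
    (Module.finBasis ℂ S).equivFun.toLinearMap ∘ₗ p
  have hq : ∀ s : S, q s = (Module.finBasis ℂ S).equivFun s := fun s =>
    congrArg (Module.finBasis ℂ S).equivFun (LinearMap.congr_fun hp s)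
  let qc : (Fin d → ℂ) →L[ℝ] (Fin (Module.finrank ℂ S) → ℂ) :=
    (LinearMap.toContinuousLinearMap q).restrictScalars ℝ
  have hG : ∀ y (D : V →L[ℝ] (Fin d → ℂ)), HasMFDerivAt 𝓘(ℝ, V) 𝓘(ℝ, Fin d → ℂ) (e ∘ σ) y D →
      HasMFDerivAt 𝓘(ℝ, V) 𝓘(ℝ, Fin (Module.finrank ℂ S) → ℂ) (qc ∘ e ∘ σ) y (qc.comp D) :=
    fun y D hD => qc.hasMFDerivAt.comp y hD
  have hbij : Function.Bijective (qc.comp D : V →ₗ[ℝ] (Fin (Module.finrank ℂ S) → ℂ)) := by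
    constructor
    · intro v w hvw
      have h1 : q (⟨D v, v, rfl⟩ : S) = q (⟨D w, w, rfl⟩ : S) := hvw
      rw [hq, hq] at h1
      exact hDinj (congrArg Subtype.val ((Module.finBasis ℂ S).equivFun.injective h1))
    · intro a
      obtain ⟨v, hv⟩ := ((Module.finBasis ℂ S).equivFun.symm a).2
      refine ⟨v, ?_⟩
      change q (D v) = a
      rw [hv, hq, LinearEquiv.apply_symm_apply]
  let G' : V ≃L[ℝ] (Fin (Module.finrank ℂ S) → ℂ) :=
    (LinearEquiv.ofBijective _ hbij).toContinuousLinearEquiv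
  have hG' : HasMFDerivAt 𝓘(ℝ, V) 𝓘(ℝ, Fin (Module.finrank ℂ S) → ℂ) (qc ∘ e ∘ σ) x
      (G' : V →L[ℝ] (Fin (Module.finrank ℂ S) → ℂ)) := by
    convert! hG x D hD
  have hGs : ContMDiffOn 𝓘(ℝ, V) 𝓘(ℝ, Fin (Module.finrank ℂ S) → ℂ) ∞ (qc ∘ e ∘ σ) U :=
    qc.contMDiff.comp_contMDiffOn (he.comp hσ.contMDiffOn fun y hy => hy)
  have : CompleteSpace V := FiniteDimensional.complete ℝ V
  obtain ⟨c, hxc, hcU, hcG, hcs, hcs'⟩ :=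
    exists_openPartialHomeomorph_of_hasMFDerivAt hUo hGs hxe hG'
  refine ⟨_, c, hxc, hcs, hcs', fun y hy v i => ?_⟩
  -- Away from `x` the image of the derivative need not be `S`, but complex linearity of `q` is all
  -- that is used.
  obtain ⟨D, hD, -, hDJ⟩ := hF y (hcU hy)
  have h1 : c =ᶠ[nhds y] qc ∘ e ∘ σ := by
    filter_upwards [c.open_source.mem_nhds hy] with z hz using hcG hz
  rw [h1.mfderiv_eq, (hG y D hD).mfderiv]
  change q (D (J y v)) i = Complex.I * q (D v) i
  rw [hDJ, map_smul]
  rfl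

end ComplexSubmanifold

/-! ### The structure that a holomorphic section induces on `M`. -/

section HolomorphicSections

variable {m : ℕ} {M : Type*} [TopologicalSpace M]
  [ChartedSpace (EuclideanSpace ℝ (Fin (2 * m + 1 + 1))) M]
  [IsManifold (𝓡 (2 * m + 1 + 1)) ∞ M]
  {E : M → Type*} [∀ p, AddCommGroup (E p)] [∀ p, Module ℝ (E p)] [∀ p, TopologicalSpace (E p)]
  [TopologicalSpace (TotalSpace Plane E)] [FiberBundle Plane E] [VectorBundle ℝ Plane E]

theorem GL2Structure.exists_coframe_apply_eq_I_smul (Θ : GL2Structure (2 * m + 1) E)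
    (b : FrameBundle E) :
    ∃ J : TangentSpace (𝓡 (2 * m + 1 + 1)) b.1.1 →L[ℝ] TangentSpace (𝓡 (2 * m + 1 + 1)) b.1.1,
      ∀ v, Θ.coframe b (J v) = Complex.I • Θ.coframe b v := by
  let J : EuclideanSpace ℝ (Fin (2 * m + 1 + 1)) →ₗ[ℝ] EuclideanSpace ℝ (Fin (2 * m + 1 + 1)) :=
    (Θ.coframe b).symm.toLinearMap ∘ₗ
      ((Complex.I • LinearMap.id : (Fin (m + 1) → ℂ) →ₗ[ℂ] _).restrictScalars ℝ) ∘ₗ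
        (Θ.coframe b).toLinearMap
  refine ⟨(LinearMap.toContinuousLinearMap J :), fun v => ?_⟩
  exact (Θ.coframe b).apply_symm_apply _

variable [ContMDiffVectorBundle ∞ Plane E (𝓡 (2 * m + 1 + 1))]

/-- Differentiating `proj ∘ σ = id` shows that `dσ` is injective and recovers a vector of `M` from
its image. -/
theorem IsHolomorphicSection.mfderiv_proj_mfderiv {Θ : GL2Structure (2 * m + 1) E}
    {φ : GL2Connection (2 * m + 1 + 1) E} {σ : M → ConfFrame E}
    (hσ : IsHolomorphicSection Θ φ σ) (p : M) (v : TangentSpace (𝓡 (2 * m + 1 + 1)) p) :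
    mfderiv 𝓘(ℝ, EuclideanSpace ℝ (Fin (2 * m + 1 + 1)) × ℂ) (𝓡 (2 * m + 1 + 1))
      (ConfFrame.proj (E := E)) (σ p)
      (mfderiv (𝓡 (2 * m + 1 + 1)) 𝓘(ℝ, EuclideanSpace ℝ (Fin (2 * m + 1 + 1)) × ℂ) σ p v) =
      v := by
  have h := mfderiv_comp p
    (ConfFrame.hasMFDerivAt_proj (2 * m + 1 + 1) (σ p)).mdifferentiableAt
    (hσ.smooth.mdifferentiable (by simp) p)
  have h1 : ConfFrame.proj ∘ σ = id := funext hσ.proj_eq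
  rw [h1, mfderiv_id] at h
  exact (DFunLike.congr_fun h v).symm

/-- Let `J` be multiplication by `i` in the coframe of the representative `b` supplied by
`almostComplexStructure_spec`. Invariance gives `J_φ dσ(v) = dσ(w)`, and the projection of the left
side to `M` is `J v`, because the `ξ_j` determine that projection. Hence `w = J v`. -/
theorem IsHolomorphicSection.exists_complexStructure {Θ : GL2Structure (2 * m + 1) E}
    {φ : GL2Connection (2 * m + 1 + 1) E} {σ : M → ConfFrame E}
    (hσ : IsHolomorphicSection Θ φ σ) (p : M) :
    ∃ J : TangentSpace (𝓡 (2 * m + 1 + 1)) p →L[ℝ] TangentSpace (𝓡 (2 * m + 1 + 1)) p,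
      (∀ v, mfderiv (𝓡 (2 * m + 1 + 1)) 𝓘(ℝ, EuclideanSpace ℝ (Fin (2 * m + 1 + 1)) × ℂ) σ p
          (J v) = almostComplexStructure Θ φ (σ p) (mfderiv (𝓡 (2 * m + 1 + 1))
            𝓘(ℝ, EuclideanSpace ℝ (Fin (2 * m + 1 + 1)) × ℂ) σ p v)) ∧
      ∃ b : FrameBundle E, ∃ h : p = b.1.1, ConfFrame.mk b = σ p ∧
        Θ.IsComplexStructureAt b (h ▸ J) := by
  obtain ⟨b, hb, hspec⟩ := almostComplexStructure_spec Θ φ (σ p)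
  obtain rfl : p = b.1.1 := by rw [← hσ.proj_eq p, ← hb]; rfl
  obtain ⟨J, hJ⟩ := Θ.exists_coframe_apply_eq_I_smul b
  refine ⟨J, fun v => ?_, b, rfl, hb, Θ.isComplexStructureAt_of_coframe b hJ⟩
  obtain ⟨w, hw⟩ := hσ.invariant b.1.1 v
  have hv := hσ.mfderiv_proj_mfderiv b.1.1 v
  have hwp := hσ.mfderiv_proj_mfderiv b.1.1 w
  rw [hw]
  rw [← hw] at hwp
  congr 1
  -- The type of `dσ(v)` mentions `σ b.1.1`; generalizing both allows the point to be replaced by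
  -- `ConfFrame.mk b`.
  generalize mfderiv (𝓡 (2 * m + 1 + 1)) 𝓘(ℝ, EuclideanSpace ℝ (Fin (2 * m + 1 + 1)) × ℂ) σ
    b.1.1 v = s at hv hwp
  generalize σ b.1.1 = χ at *
  subst hb
  obtain ⟨t, rfl⟩ := mfderiv_mk_surjective b s
  -- `t` lifts `dσ(v)` to `B(E)`. The vector `t'` lies over `J v` with `ζ(t') = i ζ(t)`, so the
  -- defining property of `J_φ` sends the image of `t` to that of `t'`.
  obtain ⟨t', ht1, ht2⟩ := φ.exists_mfderiv_base_eq_and_zeta_eq b (J v) (Complex.I * φ.zeta b t)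
  rw [mfderiv_proj_mfderiv_mk] at hv
  have h1 := hspec t t' (fun j => by
    rw [← Θ.coframe_mfderiv_apply, ← Θ.coframe_mfderiv_apply, ht1, hv, hJ]
    rfl) ht2
  rw [h1, mfderiv_proj_mfderiv_mk, ht1] at hwp
  exact hwp

end HolomorphicSections

end GL2

theorem mainTheorem6 {m : ℕ} {M : Type*} [TopologicalSpace M]
    [ChartedSpace (EuclideanSpace ℝ (Fin (2 * m + 1 + 1))) M]
    [IsManifold (𝓡 (2 * m + 1 + 1)) ∞ M]
    {E : M → Type*} [∀ p, AddCommGroup (E p)] [∀ p, Module ℝ (E p)] [∀ p, TopologicalSpace (E p)]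
    [TopologicalSpace (TotalSpace GL2.Plane E)] [FiberBundle GL2.Plane E]
    [VectorBundle ℝ GL2.Plane E] [ContMDiffVectorBundle ∞ GL2.Plane E (𝓡 (2 * m + 1 + 1))]
    (Θ : GL2.GL2Structure (2 * m + 1) E) (φ : GL2.GL2Connection (2 * m + 1 + 1) E)
    (hφ : GL2.IsIntegrable (GL2.almostComplexStructure Θ φ))
    (σ : M → GL2.ConfFrame E) (hσ : GL2.IsHolomorphicSection Θ φ σ) :
    ∃ J : ∀ p : M, TangentSpace (𝓡 (2 * m + 1 + 1)) p →L[ℝ] TangentSpace (𝓡 (2 * m + 1 + 1)) p,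
      (∀ b : GL2.FrameBundle E, (σ b.1.1).line = b.line → Θ.IsComplexStructureAt b (J b.1.1)) ∧
        GL2.IsIntegrable J := by
  choose J hJ hJz using hσ.exists_complexStructure
  refine ⟨J, fun b hb => ?_, hφ.of_immersion hσ.smooth (fun p v w h => ?_) hJ⟩
  -- The structure is known at one representative `b'` of `σ`; a frame with the same line differs
  -- from it by `CO(2)`.
  · obtain ⟨b', h, hb', hc⟩ := hJz b.1.1
    rw [← hb'] at hb
    obtain ⟨g, hg, rfl⟩ := GL2.ConfFrame.mk_eq_mk.1 (GL2.FrameBundle.mk_eq_mk_of_line_eq hb)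
    exact Θ.isComplexStructureAt_act b' hg hc
  · rw [← hσ.mfderiv_proj_mfderiv p v, h, hσ.mfderiv_proj_mfderiv p w]
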